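/- Let $\mathfrak g=\mathfrak b\oplus\mathfrak z$ be a two-step Lie algebra of Heisenberg type: $\mathfrak g$ carries an inner product, $\mathfrak z$ is its center, $[\mathfrak g,\mathfrak g]\subseteq\mathfrak z$, $\mathfrak b=\mathfrak z^{\perp}$, and for every $Z\in\mathfrak z$ the map $J_Z:\mathfrak b\to\mathfrak b$ with $\langle J_ZX,Y\rangle=\langle Z,[X,Y]\rangle$ satisfies $J_Z^2=-|Z|^2I$. Let $B_1,\dots,B_{2n}$ ($n\ge 1$) and $Z_1,\dots,Z_m$ be orthonormal bases of $\mathfrak b$ and $\mathfrak z$, let $U^{(k)}=(\langle[B_j,B_l],Z_k\rangle)_{j,l}$, and for $\lambda\in\mathbb R^m\setminus\{0\}$ put $V_\lambda=\sum_k\lambda_kU^{(k)}$. Identify $x=(x_1,\dots,x_n,y_1,\dots,y_n)\in\mathbb R^{2n}$ with its complexification $z=(x_j+iy_j)_j\in\mathbb C^n$. The $\lambda$-twisted convolution on $\mathbb C^n$ is $$f\times_\lambda h(z)=\int_{\mathbb C^n}f(z-w)\,h(w)\,e^{\frac i2\langle x,V_\lambda\xi\rangle}\,dw,$$ where $z,w$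 are the complexifications of $x,\xi$. For $N\ge1$ and $\tau>0$ the standard $\tau$-twisted convolution on $\mathbb C^N$ is $$f\times_\tau h(z)=\int_{\mathbb C^N}f(z-w)\,h(w)\,e^{\frac{i\tau}2\operatorname{Im}(z\cdot\bar w)}\,dw.$$ Let $A_\lambda$ be an orthogonal $2n\times2n$ matrix with $V_\lambda A_\lambda=A_\lambda\begin{pmatrix}0&-D\\D&0\end{pmatrix}$, where $D=\operatorname{diag}(\mu_1,\dots,\mu_n)$ and $\mu_1\ge\dots\ge\mu_n>0$. For a function $f$ on $\mathbb C^n$ let $f_\lambda(z)=f(\tilde z_\lambda)$, where $z$ and $\tilde z_\lambda$ are the complexifications of $x$ and $A_\lambda x$. Let $H_{p,q}$ be the space of harmonic polynomials on $\mathbb C^n$ of the form $\sum_{|\alpha|=p,|\beta|=q}c_{\alpha\beta}z^\alpha\bar z^\beta$, and let $$H^\lambda_{p,q}=\Big\{P\in\bigoplus_{p'+q'=p+q}H_{p',q'}:\ P_\lambda\in H_{p,q}\Big\}.$$ Let $\varphi^{a}_{k,\lambda}(z)=L^{a}_k\big(\tfrac12|\lambda||z|^2\big)e^{-\frac14|\lambda||z|^2}$,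 where $L^a_k$ is the Laguerre polynomial of degree $k$ and type $a$. **Theorem.** Let $f\in L^1(\mathbb C^n)$ be of the form $f=gP$, where $g$ is radial, $g(z)=g_0(|z|)$, and $P\in H^\lambda_{p,q}$ with $p,q\ge0$. Then for all $k\ge0$ and $z\in\mathbb C^n$: if $k\ge p$, then for every $z'\in\mathbb C^{n+p+q}$ with $|z'|=|z|$, $$f\times_\lambda\varphi^{n-1}_{k,\lambda}(z)=(2\pi)^{-(p+q)}|\lambda|^{p+q}\,P(z)\;\big(g\times_{|\lambda|}\varphi^{n+p+q-1}_{k-p,\lambda}\big)(z'),$$ where the convolution on the right is the standard $|\lambda|$-twisted convolution on $\mathbb C^{n+p+q}$ and $g$ there denotes the radial function $w\mapsto g_0(|w|)$ on $\mathbb C^{n+p+q}$; and if $k<p$, then $f\times_\lambda\varphi^{n-1}_{k,\lambda}(z)=0$. The integrals defining both convolutions converge absolutely (the one on the right provided $P\not\equiv0$). -/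

import Mathlib

open MeasureTheory Matrix

noncomputable section

namespace HTypeHecke

/-! ### Lie algebras of Heisenberg type -/

section LieAlgebraPart

variable {𝔤 : Type*} [LieRing 𝔤] [LieAlgebra ℝ 𝔤]

/-- The orthogonal complement `𝔟` of the center `𝔷` of `𝔤` with respect to `ip`. -/
def horizontal (ip : LinearMap.BilinForm ℝ 𝔤) : Submodule ℝ 𝔤 :=
  ip.orthogonal (LieAlgebra.center ℝ 𝔤).toSubmodule

/-- `𝔤`, with the inner product `ip`, is a two-step Lie algebra of Heisenberg type: for every `Z`
in the center `𝔷`, the map `J_Z : 𝔟 → 𝔟` given by `⟨J_Z X, Y⟩ = ⟨Z, [X, Y]⟩` satisfies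
`J_Z ^ 2 = -|Z|^2 I`. -/
structure IsHType (ip : LinearMap.BilinForm ℝ 𝔤) : Prop where
  symm : ∀ x y : 𝔤, ip x y = ip y x
  pos : ∀ x : 𝔤, x ≠ 0 → 0 < ip x x
  bracket_mem_center : ∀ x y : 𝔤, ⁅x, y⁆ ∈ LieAlgebra.center ℝ 𝔤
  exists_J : ∀ Z ∈ LieAlgebra.center ℝ 𝔤, ∃ J : horizontal ip →ₗ[ℝ] horizontal ip,
    (∀ X Y : horizontal ip, ip (J X : 𝔤) (Y : 𝔤) = ip Z ⁅(X : 𝔤), (Y : 𝔤)⁆) ∧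
      J ∘ₗ J = -(ip Z Z) • LinearMap.id

/-- `e` is an orthonormal basis `B_1, …, B_{2n}, Z_1, …, Z_m` of `𝔤` with all `B_j` in `𝔟` and all
`Z_k` in the center. The index set of the `B_j` is split into two copies of `Fin n`, matching the
coordinates `(x_1, …, x_n, y_1, …, y_n)` of `ℝ^{2n}`. -/
structure IsAdaptedBasis (ip : LinearMap.BilinForm ℝ 𝔤) {n m : ℕ}
    (e : Module.Basis ((Fin n ⊕ Fin n) ⊕ Fin m) ℝ 𝔤) : Prop where
  orthonormal : ∀ i j, ip (e i) (e j) = if i = j then 1 else 0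
  mem_horizontal : ∀ j, e (Sum.inl j) ∈ horizontal ip
  mem_center : ∀ k, e (Sum.inr k) ∈ LieAlgebra.center ℝ 𝔤

/-- The matrices `U^{(k)}` of structure constants: `[B_j, B_l] = ∑ k, U^{(k)}_{j,l} Z_k`. -/
def structureMatrix (ip : LinearMap.BilinForm ℝ 𝔤) {n m : ℕ}
    (e : Module.Basis ((Fin n ⊕ Fin n) ⊕ Fin m) ℝ 𝔤) (k : Fin m) :
    Matrix (Fin n ⊕ Fin n) (Fin n ⊕ Fin n) ℝ :=
  Matrix.of fun j l => ip (e (Sum.inr k)) ⁅e (Sum.inl j), e (Sum.inl l)⁆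

/-- `V_λ = ∑ k, λ_k U^{(k)}`. -/
def twistMatrix (ip : LinearMap.BilinForm ℝ 𝔤) {n m : ℕ}
    (e : Module.Basis ((Fin n ⊕ Fin n) ⊕ Fin m) ℝ 𝔤) (lam : EuclideanSpace ℝ (Fin m)) :
    Matrix (Fin n ⊕ Fin n) (Fin n ⊕ Fin n) ℝ :=
  ∑ k, lam k • structureMatrix ip e k

end LieAlgebraPart

/-! ### Complexification -/

/-- The real coordinates `(x_1, …, x_n, y_1, …, y_n)` of `z = x + i y ∈ ℂⁿ`. -/
def realify {n : ℕ} (z : EuclideanSpace ℂ (Fin n)) : Fin n ⊕ Fin n → ℝ :=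
  Sum.elim (fun j => (z j).re) (fun j => (z j).im)

/-- The complexification of `(x_1, …, x_n, y_1, …, y_n) ∈ ℝ^{2n}`. -/
def complexify {n : ℕ} (x : Fin n ⊕ Fin n → ℝ) : EuclideanSpace ℂ (Fin n) :=
  WithLp.toLp 2 fun j => (⟨x (Sum.inl j), x (Sum.inr j)⟩ : ℂ)

/-- The columns of `A` are, up to the factor `√2`, the vectors `v_1, …, v_n, u_1, …, u_n`, where
the `u_j ± i v_j` are orthonormal eigenvectors of the skew-symmetric matrix `V` with eigenvalues
`± i μ_j` and `μ_1 ≥ ⋯ ≥ μ_n > 0`. Equivalently, `A` is orthogonal and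
`V A = A [[0, -diag μ], [diag μ, 0]]`. -/
structure IsSymplecticFrame {n : ℕ} (V A : Matrix (Fin n ⊕ Fin n) (Fin n ⊕ Fin n) ℝ)
    (μ : Fin n → ℝ) : Prop where
  orthogonal : A ∈ Matrix.orthogonalGroup (Fin n ⊕ Fin n) ℝ
  pos : ∀ j, 0 < μ j
  antitone : Antitone μ
  intertwine : V * A =
    A * Matrix.fromBlocks 0 (-Matrix.diagonal μ) (Matrix.diagonal μ) 0

/-- `f_λ(z) = f(complexification of A x)`, where `z` is the complexification of `x`. -/
def rotate {n : ℕ} (A : Matrix (Fin n ⊕ Fin n) (Fin n ⊕ Fin n) ℝ)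
    (f : EuclideanSpace ℂ (Fin n) → ℂ) : EuclideanSpace ℂ (Fin n) → ℂ :=
  fun z => f (complexify (A *ᵥ realify z))

/-! ### Bigraded harmonic polynomials -/

/-- The space `P_{p,q}` of polynomial functions `∑ c_{αβ} z^α z̄^β`, `|α| = p`, `|β| = q`. -/
def bigradedPoly (n p q : ℕ) : Submodule ℂ (EuclideanSpace ℂ (Fin n) → ℂ) :=
  Submodule.span ℂ {P | ∃ α β : Fin n → ℕ, ∑ j, α j = p ∧ ∑ j, β j = q ∧
    P = fun z => (∏ j, z j ^ α j) * ∏ j, (starRingEnd ℂ (z j)) ^ β j}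

theorem contDiff_of_mem_bigradedPoly {n p q : ℕ} {P : EuclideanSpace ℂ (Fin n) → ℂ}
    (hP : P ∈ bigradedPoly n p q) : ContDiff ℝ 2 P := by
  induction hP using Submodule.span_induction with
  | mem P hP =>
    obtain ⟨α, β, -, -, rfl⟩ := hP
    have h : ∀ j : Fin n, ContDiff ℝ 2 fun z : EuclideanSpace ℂ (Fin n) => z j :=
      fun j => contDiff_piLp_apply (𝕜 := ℝ) 2
    refine (contDiff_prod fun j _ => (h j).pow _).mul (contDiff_prod fun j _ => ?_)
    exact (Complex.conjCLE.contDiff.comp (h j)).pow _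
  | zero => exact contDiff_const
  | add x y _ _ hx hy => exact hx.add hy
  | smul a x _ hx => exact hx.const_smul a

open InnerProductSpace Laplacian in
/-- The space `H_{p,q}` of elements of `P_{p,q}` annihilated by the Laplacian of `ℂⁿ = ℝ^{2n}`. -/
def bigradedHarmonic (n p q : ℕ) : Submodule ℂ (EuclideanSpace ℂ (Fin n) → ℂ) where
  carrier := {P : EuclideanSpace ℂ (Fin n) → ℂ | P ∈ bigradedPoly n p q ∧ ∀ z, (Δ P) z = (0 : ℂ)}
  zero_mem' := by
    refine ⟨zero_mem _, fun z => ?_⟩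
    simpa using laplacian_smul (𝕜 := ℝ) (f := (0 : EuclideanSpace ℂ (Fin n) → ℂ)) (x := z)
      (0 : ℝ) contDiffAt_const
  add_mem' := by
    intro f g hf hg
    refine ⟨add_mem hf.1 hg.1, fun z => ?_⟩
    rw [(contDiff_of_mem_bigradedPoly hf.1).contDiffAt.laplacian_add
      (contDiff_of_mem_bigradedPoly hg.1).contDiffAt, hf.2 z, hg.2 z, add_zero]
  smul_mem' := by
    intro c f hf
    refine ⟨Submodule.smul_mem _ c hf.1, fun z => ?_⟩
    rw [laplacian_smul c (contDiff_of_mem_bigradedPoly hf.1).contDiffAt, hf.2 z, smul_zero]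

/-- The space `H^λ_{p,q}` of all `P` in the sum of the `H_{p',q'}`, `p' + q' = p + q`, such that
`P_λ ∈ H_{p,q}`. The dependence on `λ` is through `A = A_λ`. -/
def twistedHarmonic {n : ℕ} (A : Matrix (Fin n ⊕ Fin n) (Fin n ⊕ Fin n) ℝ) (p q : ℕ) :
    Set (EuclideanSpace ℂ (Fin n) → ℂ) :=
  {P | P ∈ (⨆ (r : ℕ × ℕ) (_ : r.1 + r.2 = p + q), bigradedHarmonic n r.1 r.2) ∧
    rotate A P ∈ bigradedHarmonic n p q}

/-! ### Laguerre functions and twisted convolutions -/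

/-- The Laguerre polynomial `L_k^a(x) = ∑_{i ≤ k} binom(k + a, k - i) (-x)^i / i!`. -/
def laguerre (k a : ℕ) (x : ℝ) : ℝ :=
  ∑ i ∈ Finset.range (k + 1), ((k + a).choose (k - i) : ℝ) * (-x) ^ i / (i.factorial : ℝ)

/-- The Laguerre function `φ_k^a(z) = L_k^a(|z|^2 / 2) exp(-|z|^2 / 4)`. -/
def laguerreFun {N : ℕ} (k a : ℕ) (z : EuclideanSpace ℂ (Fin N)) : ℝ :=
  laguerre k a (‖z‖ ^ 2 / 2) * Real.exp (-‖z‖ ^ 2 / 4)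

/-- The scaled Laguerre function `φ_k^a(τ^{1/2} z)`, to be used with `τ = |λ|`. -/
def scaledLaguerreFun {N : ℕ} (τ : ℝ) (k a : ℕ) (z : EuclideanSpace ℂ (Fin N)) : ℝ :=
  laguerreFun k a (Real.sqrt τ • z)

/-- The integrand `f(z - w) g(w) exp((i/2) ⟨x, V ξ⟩)` of the twisted convolution with twist `V`,
where `z`, `w` are the complexifications of `x`, `ξ`. For `V = V_λ` the exponent is
`(i/2) ∑_j λ_j Re(z · conj(U^{(j)} w))`. -/
def twistedIntegrand {n : ℕ} (V : Matrix (Fin n ⊕ Fin n) (Fin n ⊕ Fin n) ℝ)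
    (f g : EuclideanSpace ℂ (Fin n) → ℂ) (z w : EuclideanSpace ℂ (Fin n)) : ℂ :=
  f (z - w) * g w * Complex.exp (Complex.I / 2 * ((realify z ⬝ᵥ V *ᵥ realify w : ℝ) : ℂ))

/-- The twisted convolution with twist `V`; for `V = V_λ` it is `f ×_λ g`. -/
def twistedConv {n : ℕ} (V : Matrix (Fin n ⊕ Fin n) (Fin n ⊕ Fin n) ℝ)
    (f g : EuclideanSpace ℂ (Fin n) → ℂ) (z : EuclideanSpace ℂ (Fin n)) : ℂ :=
  ∫ w, twistedIntegrand V f g z w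

/-- The integrand `f(z - w) g(w) exp((i τ/2) Im(z · w̄))` of the standard (Heisenberg group)
`τ`-twisted convolution on `ℂ^N`. -/
def heisenbergIntegrand {N : ℕ} (τ : ℝ) (f g : EuclideanSpace ℂ (Fin N) → ℂ)
    (z w : EuclideanSpace ℂ (Fin N)) : ℂ :=
  f (z - w) * g w *
    Complex.exp (Complex.I / 2 * ((τ * (∑ j, z j * starRingEnd ℂ (w j)).im : ℝ) : ℂ))

/-- The standard `τ`-twisted convolution on `ℂ^N`. -/
def heisenbergConv {N : ℕ} (τ : ℝ) (f g : EuclideanSpace ℂ (Fin N) → ℂ)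
    (z : EuclideanSpace ℂ (Fin N)) : ℂ :=
  ∫ w, heisenbergIntegrand τ f g z w

end HTypeHecke

end

namespace HTypeHecke

/-! ### The generating function of the Laguerre polynomials -/

/-! Put τ = |λ|. The Heisenberg type condition forces V_λ² = -τ² (`twistMatrix_mul_self`), so every
μ_j equals τ and A_λ is an isometry that carries the λ-twisted convolution to the standard τ-twisted
one. Radial factors are unaffected and P becomes P_λ = Q(z, z̄), harmonic of bidegree (p, q). What
remains is a Hecke–Bochner identity on ℂⁿ for the standard twist.

There, convolution with φ_k is integration against K_k(z, u) = φ_k(z - u) exp(-(iτ/2) Im z·ū). By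
the Laguerre generating function, ∑ r^k K_k(z, u) is, up to a factor free of u, exp(-κ|u|² + β z̄·u
+ α z·ū) with κ = τ(1 + r)/(4(1 - r)), β = τ/(2(1 - r)) and α = rβ. Integrate this against
exp(-t|u|²) Q and put T = t + κ: a harmonic polynomial contributes its value at (αz/T, βz̄/T) times
the pure Gaussian integral (`gaussMoment_harmonic`), and bidegree turns that value into α^p β^q
T^{-(p+q)} Q(z, z̄). The factor r^p coming from α shifts k to k - p and kills k < p. The remaining
powers of (1 - r)⁻¹ and π/T raise the exponent n to n + p + q, which leaves exactly the generating
function for Q = 1 on ℂ^{n+p+q}. Comparing coefficients settles Gaussian g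
(`integral_exp_mul_laguerreKernel`).

General g follows from moments. Any radial function is a function of ψ = exp(-|u|²) ∈ [0, 1], and
the Gaussian case with t = m says that the densities Q K_k on ℂⁿ and a multiple of K_{k-p} on
ℂ^{n+p+q} give ψ the same m-th moment. Moments on [0, 1] determine the law
(`integral_mul_eq_of_moments_eq`). Convergence of the integral on ℂ^{n+p+q} also comes from moments:
|Q|² on ℂⁿ and 1 on ℂ^{n+p+q} have proportional radial parts (`densityLaw_norm_sq_conjEval`). -/

theorem hasSum_antidiagonal_laguerre (a : ℕ) {r x : ℝ} (hr : |r| < 1) :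
    HasSum (fun c : ℕ × ℕ => ((c.2 + c.1 + a).choose c.2 : ℝ) * r ^ c.2 *
      ((-x * r) ^ c.1 / (c.1.factorial : ℝ)))
      ((1 - r)⁻¹ ^ (a + 1) * Real.exp (-r * x / (1 - r))) := by
  -- For fixed `c.1` the sum over `c.2` is a negative binomial series; the sum over `c.1` is then an
  -- exponential series.
  have inner : ∀ (s y : ℝ) (i : ℕ), |s| < 1 →
      HasSum (fun j : ℕ => ((j + i + a).choose j : ℝ) * s ^ j * (y ^ i / (i.factorial : ℝ)))
        ((1 - s)⁻¹ ^ (a + 1) * ((y * (1 - s)⁻¹) ^ i / (i.factorial : ℝ))) := by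
    intro s y i hs
    have h := (hasSum_choose_mul_geometric_of_norm_lt_one (𝕜 := ℝ) (i + a) (r := s)
      (by simpa using hs)).mul_right (y ^ i / (i.factorial : ℝ))
    convert! h using 1
    · funext j
      rw [← Nat.choose_symm_of_eq_add (show j + (i + a) = j + (i + a) from rfl), add_assoc]
    · rw [mul_pow, one_div, show i + a + 1 = (a + 1) + i by ring, ← inv_pow, pow_add]
      ring
  have outer : ∀ (s y : ℝ), HasSum
      (fun i : ℕ => (1 - s)⁻¹ ^ (a + 1) * ((y * (1 - s)⁻¹) ^ i / (i.factorial : ℝ)))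
      ((1 - s)⁻¹ ^ (a + 1) * Real.exp (y * (1 - s)⁻¹)) := by
    intro s y
    have h := NormedSpace.expSeries_div_hasSum_exp (𝔸 := ℝ) (y * (1 - s)⁻¹)
    rw [← Real.exp_eq_exp_ℝ] at h
    exact h.mul_left _
  -- The same two sums with |r| and |x| have nonnegative terms, which gives absolute convergence of
  -- the double series.
  have habs : Summable fun c : ℕ × ℕ => ((c.2 + c.1 + a).choose c.2 : ℝ) * |r| ^ c.2 *
      ((|x| * |r|) ^ c.1 / (c.1.factorial : ℝ)) := by
    rw [summable_prod_of_nonneg]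
    · refine ⟨fun i => (inner |r| (|x| * |r|) i (by simpa using hr)).summable, ?_⟩
      refine (outer |r| (|x| * |r|)).summable.congr fun i => ?_
      exact (inner |r| (|x| * |r|) i (by simpa using hr)).tsum_eq.symm
    · intro c
      positivity
  have hsum : Summable fun c : ℕ × ℕ => ((c.2 + c.1 + a).choose c.2 : ℝ) * r ^ c.2 *
      ((-x * r) ^ c.1 / (c.1.factorial : ℝ)) := by
    refine Summable.of_norm (habs.congr fun c => ?_)
    simp
  have h1 := hsum.hasSum.prod_fiberwise fun i => inner r (-x * r) i hr
  have h2 := h1.unique (outer r (-x * r))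
  rw [show -r * x / (1 - r) = -x * r * (1 - r)⁻¹ by ring, ← h2]
  exact hsum.hasSum

theorem hasSum_laguerre (a : ℕ) {r : ℝ} (x : ℝ) (hr : |r| < 1) :
    HasSum (fun k => laguerre k a x * r ^ k)
      ((1 - r)⁻¹ ^ (a + 1) * Real.exp (-r * x / (1 - r))) := by
  have h := (Finset.HasAntidiagonal.sigmaAntidiagonalEquivProd (A := ℕ)).hasSum_iff.mpr
    (hasSum_antidiagonal_laguerre a (x := x) hr)
  have h2 := h.sigma fun k => hasSum_fintype _
  convert! h2 using 1
  funext k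
  rw [Finset.univ_eq_attach]
  simp only [Function.comp_apply, Finset.HasAntidiagonal.sigmaAntidiagonalEquivProd_apply]
  rw [Finset.sum_attach (Finset.HasAntidiagonal.antidiagonal k) fun c => ((c.2 + c.1 + a).choose c.2 : ℝ) * r ^ c.2 *
      ((-x * r) ^ c.1 / (c.1.factorial : ℝ)), Finset.Nat.sum_antidiagonal_eq_sum_range_succ_mk,
    laguerre, Finset.sum_mul]
  refine Finset.sum_congr rfl fun i hi => ?_
  have hik : i ≤ k := Nat.lt_succ_iff.mp (Finset.mem_range.mp hi)
  simp only
  rw [show k - i + i + a = k + a by omega, mul_pow]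
  rw [show r ^ k = r ^ (k - i) * r ^ i by rw [← pow_add, Nat.sub_add_cancel hik]]
  ring

/-- The terms of L_k^a(-x) are nonnegative for x ≥ 0, so L_k^a(-x) dominates |L_k^a(x)| and is
itself bounded by the whole generating series at r = 1/4. Any r < 1/3 would do: the growth rate r/(1
- r) must stay below the 1/2 supplied by the Gaussian factor of φ_k. -/
theorem abs_laguerre_le (k a : ℕ) {x : ℝ} (hx : 0 ≤ x) :
    |laguerre k a x| ≤ (4 / 3) ^ (a + 1) * 4 ^ k * Real.exp (x / 3) := by
  have h1 : |laguerre k a x| ≤ laguerre k a (-x) := by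
    refine (Finset.abs_sum_le_sum_abs _ _).trans (le_of_eq (Finset.sum_congr rfl fun i _ => ?_))
    simp [abs_div, abs_mul, abs_pow, abs_of_nonneg hx]
  have h2 := hasSum_laguerre a (r := 1 / 4) (-x) (by rw [abs_of_pos] <;> norm_num)
  have h3 : laguerre k a (-x) * (1 / 4) ^ k ≤ _ := le_hasSum h2 k fun j _ => by
    have : 0 ≤ laguerre j a (-x) := Finset.sum_nonneg fun i _ => by
      rw [neg_neg]
      positivity
    positivity
  rw [show -(1 / 4 : ℝ) * -x / (1 - 1 / 4) = x / 3 by ring,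
    show (1 - 1 / 4 : ℝ)⁻¹ = 4 / 3 by norm_num] at h3
  have h4 : (4 : ℝ) ^ k * (1 / 4) ^ k = 1 := by rw [← mul_pow]; norm_num
  calc |laguerre k a x| ≤ laguerre k a (-x) := h1
    _ = 4 ^ k * (laguerre k a (-x) * (1 / 4) ^ k) := by linear_combination -laguerre k a (-x) * h4
    _ ≤ 4 ^ k * ((4 / 3) ^ (a + 1) * Real.exp (x / 3)) := by gcongr
    _ = (4 / 3) ^ (a + 1) * 4 ^ k * Real.exp (x / 3) := by ring

theorem continuous_laguerre (k a : ℕ) : Continuous (laguerre k a) := by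
  unfold laguerre
  fun_prop

theorem scaledLaguerreFun_eq {N : ℕ} {τ : ℝ} (hτ : 0 < τ) (k a : ℕ)
    (w : EuclideanSpace ℂ (Fin N)) :
    scaledLaguerreFun τ k a w =
      laguerre k a (τ * ‖w‖ ^ 2 / 2) * Real.exp (-(τ * ‖w‖ ^ 2) / 4) := by
  have : ‖Real.sqrt τ • w‖ ^ 2 = τ * ‖w‖ ^ 2 := by
    rw [norm_smul, mul_pow, Real.norm_eq_abs, sq_abs, Real.sq_sqrt hτ.le]
  simp only [scaledLaguerreFun, laguerreFun, this]

theorem continuous_scaledLaguerreFun {N : ℕ} (τ : ℝ) (k a : ℕ) :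
    Continuous (scaledLaguerreFun (N := N) τ k a) := by
  have := continuous_laguerre k a
  unfold scaledLaguerreFun laguerreFun
  fun_prop

theorem abs_scaledLaguerreFun_le {N : ℕ} {τ : ℝ} (hτ : 0 < τ) (k a : ℕ)
    (w : EuclideanSpace ℂ (Fin N)) :
    |scaledLaguerreFun τ k a w| ≤
      (4 / 3) ^ (a + 1) * 4 ^ k * Real.exp (-(τ / 12) * ‖w‖ ^ 2) := by
  rw [scaledLaguerreFun_eq hτ, abs_mul, Real.abs_exp]
  refine (mul_le_mul_of_nonneg_right (abs_laguerre_le k a (by positivity))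
    (Real.exp_pos _).le).trans (le_of_eq ?_)
  rw [mul_assoc, ← Real.exp_add]
  ring_nf

theorem hasSum_scaledLaguerreFun {N : ℕ} {τ r : ℝ} (hτ : 0 < τ) (hr : |r| < 1) (a : ℕ)
    (w : EuclideanSpace ℂ (Fin N)) :
    HasSum (fun k => r ^ k * scaledLaguerreFun τ k a w)
      ((1 - r)⁻¹ ^ (a + 1) * Real.exp (-(τ / 4 * ((1 + r) / (1 - r))) * ‖w‖ ^ 2)) := by
  have h := (hasSum_laguerre a (τ * ‖w‖ ^ 2 / 2) hr).mul_right (Real.exp (-(τ * ‖w‖ ^ 2) / 4))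
  convert! h using 1
  · funext k
    rw [scaledLaguerreFun_eq hτ]
    ring
  · rw [mul_assoc, ← Real.exp_add]
    have : 1 - r ≠ 0 := by have := (abs_lt.mp hr).2; linarith
    congr 2
    field_simp
    ring

/-- Power series with the same sum near `0` have the same coefficients. -/
theorem eq_of_hasSum_pow {α β : ℕ → ℂ} {ε : ℝ} (hε : 0 < ε) {F : ℝ → ℂ}
    (hα : ∀ r : ℝ, |r| < ε → HasSum (fun k => (r : ℂ) ^ k * α k) (F r))
    (hβ : ∀ r : ℝ, |r| < ε → HasSum (fun k => (r : ℂ) ^ k * β k) (F r)) : α = β := by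
  have key : ∀ γ : ℕ → ℂ, (∀ r : ℝ, |r| < ε → HasSum (fun k => (r : ℂ) ^ k * γ k) (F r)) →
      HasFPowerSeriesAt F
        (fun n => ContinuousMultilinearMap.mkPiRing ℝ (Fin n) (γ n) :
          FormalMultilinearSeries ℝ ℝ ℂ) 0 := by
    intro γ hγ
    refine hasFPowerSeriesAt_iff.mpr ?_
    filter_upwards [Metric.ball_mem_nhds (0 : ℝ) hε] with r hr
    have := hγ r (by simpa using hr)
    simpa [FormalMultilinearSeries.coeff] using this
  have h := (key α hα).eq_formalMultilinearSeries (key β hβ)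
  funext n
  have h2 := congrArg (fun p : FormalMultilinearSeries ℝ ℝ ℂ => p.coeff n) h
  simpa [FormalMultilinearSeries.coeff] using h2

/-! ### Measures on the unit interval are determined by their moments -/

/-- Weierstrass approximation on [0, 1]: equal moments give equal integrals of polynomials, hence of
bounded continuous functions, and these determine a finite measure. -/
theorem measure_eq_of_moments_eq {ν ν' : Measure ℝ} [IsFiniteMeasure ν] [IsFiniteMeasure ν']
    (hν : ∀ᵐ x ∂ν, x ∈ Set.Icc (0 : ℝ) 1) (hν' : ∀ᵐ x ∂ν', x ∈ Set.Icc (0 : ℝ) 1)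
    (h : ∀ m : ℕ, ∫ x, x ^ m ∂ν = ∫ x, x ^ m ∂ν') : ν = ν' := by
  have hint : ∀ (κ : Measure ℝ) [IsFiniteMeasure κ], (∀ᵐ x ∂κ, x ∈ Set.Icc (0 : ℝ) 1) →
      ∀ m : ℕ, Integrable (fun x : ℝ => x ^ m) κ := by
    intro κ _ hκ m
    refine Integrable.of_bound (by fun_prop) 1 (hκ.mono fun x hx => ?_)
    rw [Real.norm_eq_abs, abs_pow, abs_of_nonneg hx.1]
    exact pow_le_one₀ hx.1 hx.2
  have hpoly : ∀ (κ : Measure ℝ) [IsFiniteMeasure κ], (∀ᵐ x ∂κ, x ∈ Set.Icc (0 : ℝ) 1) →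
      ∀ p : Polynomial ℝ, Integrable (fun x => p.eval x) κ ∧
        ∫ x, p.eval x ∂κ = p.sum fun i a => a * ∫ x, x ^ i ∂κ := by
    intro κ _ hκ p
    simp only [Polynomial.eval_eq_sum, Polynomial.sum]
    refine ⟨integrable_finsetSum _ fun i _ => (hint κ hκ i).const_mul _, ?_⟩
    rw [integral_finsetSum _ fun i _ => (hint κ hκ i).const_mul _]
    simp only [integral_const_mul]
  refine ext_of_forall_integral_eq_of_IsFiniteMeasure fun f => ?_
  have hclose : ∀ (κ : Measure ℝ) [IsFiniteMeasure κ], (∀ᵐ x ∂κ, x ∈ Set.Icc (0 : ℝ) 1) →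
      ∀ (p : Polynomial ℝ) (ε : ℝ), (∀ x ∈ Set.Icc (0 : ℝ) 1, |p.eval x - f x| < ε) →
        ‖∫ x, p.eval x ∂κ - ∫ x, f x ∂κ‖ ≤ ε * κ.real Set.univ := by
    intro κ _ hκ p ε hp
    rw [← integral_sub (hpoly κ hκ p).1 (f.integrable κ)]
    exact norm_integral_le_of_norm_le_const (hκ.mono fun x hx => (hp x hx).le)
  have hle : ∀ ε : ℝ, 0 < ε → ‖∫ x, f x ∂ν - ∫ x, f x ∂ν'‖ ≤
      ε * (ν.real Set.univ + ν'.real Set.univ) := by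
    intro ε hε
    obtain ⟨p, hp⟩ := exists_polynomial_near_of_continuousOn 0 1 f f.continuous.continuousOn ε hε
    have h1 := hclose ν hν p ε hp
    have h2 := hclose ν' hν' p ε hp
    have h3 : ∫ x, p.eval x ∂ν = ∫ x, p.eval x ∂ν' := by
      rw [(hpoly ν hν p).2, (hpoly ν' hν' p).2]
      simp only [h]
    rw [h3] at h1
    rw [norm_sub_rev] at h1
    calc ‖∫ x, f x ∂ν - ∫ x, f x ∂ν'‖
        ≤ ‖∫ x, f x ∂ν - ∫ x, p.eval x ∂ν'‖ + ‖∫ x, p.eval x ∂ν' - ∫ x, f x ∂ν'‖ :=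
          norm_sub_le_norm_sub_add_norm_sub _ _ _
      _ ≤ ε * (ν.real Set.univ + ν'.real Set.univ) := by rw [mul_add]; exact add_le_add h1 h2
  have hlim : Filter.Tendsto (fun ε : ℝ => ε * (ν.real Set.univ + ν'.real Set.univ))
      (nhdsWithin 0 (Set.Ioi 0)) (nhds 0) := by
    have : Filter.Tendsto (fun ε : ℝ => ε * (ν.real Set.univ + ν'.real Set.univ))
      (nhds 0) (nhds (0 * (ν.real Set.univ + ν'.real Set.univ))) :=
      (continuous_id.mul continuous_const).tendsto 0
    rw [zero_mul] at this
    exact this.mono_left nhdsWithin_le_nhds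
  have h0 : ‖∫ x, f x ∂ν - ∫ x, f x ∂ν'‖ ≤ 0 :=
    ge_of_tendsto hlim (Filter.eventually_of_mem self_mem_nhdsWithin fun ε hε => hle ε hε)
  exact sub_eq_zero.mp (norm_le_zero_iff.mp h0)

/-! ### Real and complex densities and the laws they induce on the line -/

section Density

variable {Ω : Type*} [MeasurableSpace Ω] {μ : Measure Ω} {ψ : Ω → ℝ}

/-- The law of `ψ` under the density `max h 0`. -/
noncomputable def densityLaw (μ : Measure Ω) (ψ h : Ω → ℝ) : Measure ℝ :=
  (μ.withDensity fun ω => ENNReal.ofReal (h ω)).map ψ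

theorem isFiniteMeasure_densityLaw {h : Ω → ℝ} (hh : Integrable h μ) :
    IsFiniteMeasure (densityLaw μ ψ h) := by
  have := isFiniteMeasure_withDensity_ofReal hh.2
  unfold densityLaw
  infer_instance

theorem densityLaw_mem_Icc (hψm : Measurable ψ) (hψ : ∀ ω, ψ ω ∈ Set.Icc (0 : ℝ) 1)
    (h : Ω → ℝ) : ∀ᵐ x ∂densityLaw μ ψ h, x ∈ Set.Icc (0 : ℝ) 1 := by
  exact (ae_map_iff hψm.aemeasurable measurableSet_Icc).mpr (Filter.Eventually.of_forall hψ)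

theorem integral_densityLaw (hψm : Measurable ψ) {h : Ω → ℝ} (hh : Integrable h μ)
    {E : Type*} [NormedAddCommGroup E] [NormedSpace ℝ E] {G : ℝ → E} (hG : StronglyMeasurable G) :
    ∫ x, G x ∂densityLaw μ ψ h = ∫ ω, max (h ω) 0 • G (ψ ω) ∂μ := by
  rw [densityLaw, integral_map hψm.aemeasurable hG.aestronglyMeasurable,
    integral_withDensity_eq_integral_toReal_smul₀ hh.1.aemeasurable.ennreal_ofReal
      (Filter.Eventually.of_forall fun _ => ENNReal.ofReal_lt_top)]
  simp only [ENNReal.toReal_ofReal']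

theorem integrable_posPart_smul {E : Type*} [NormedAddCommGroup E] [NormedSpace ℝ E] {h : Ω → ℝ}
    (hh : Integrable h μ) {F : Ω → E} (hF : AEStronglyMeasurable F μ)
    (hFi : Integrable (fun ω => h ω • F ω) μ) : Integrable (fun ω => max (h ω) 0 • F ω) μ := by
  refine hFi.mono ((hh.1.sup aestronglyMeasurable_const).smul hF)
    (Filter.Eventually.of_forall fun ω => ?_)
  rw [norm_smul, norm_smul]
  gcongr
  rw [Real.norm_eq_abs, Real.norm_eq_abs, abs_of_nonneg (le_max_right _ _)]
  exact max_le (le_abs_self _) (abs_nonneg _)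

/-- Jordan decomposition: `densityLaw` sees only the positive part, so the signed density is
recovered from the laws of `h` and `-h`. -/
theorem integral_smul_eq_sub {E : Type*} [NormedAddCommGroup E] [NormedSpace ℝ E] {h : Ω → ℝ}
    (hψm : Measurable ψ) (hh : Integrable h μ) {G : ℝ → E} (hG : StronglyMeasurable G)
    (hGi : Integrable (fun ω => h ω • G (ψ ω)) μ) :
    ∫ ω, h ω • G (ψ ω) ∂μ =
      ∫ x, G x ∂densityLaw μ ψ h - ∫ x, G x ∂densityLaw μ ψ (-h) := by
  have hGψ : AEStronglyMeasurable (fun ω => G (ψ ω)) μ :=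
    (hG.comp_measurable hψm).aestronglyMeasurable
  have hneg : Integrable (fun ω => (-h) ω • G (ψ ω)) μ := by
    simpa only [Pi.neg_apply, neg_smul] using! hGi.neg
  rw [integral_densityLaw hψm hh hG, integral_densityLaw hψm hh.neg hG,
    ← integral_sub (integrable_posPart_smul hh hGψ hGi)
      (integrable_posPart_smul hh.neg hGψ hneg)]
  refine integral_congr_ae (Filter.Eventually.of_forall fun ω => ?_)
  simp only [← sub_smul, Pi.neg_apply]
  congr 1
  rcases le_total (h ω) 0 with h0 | h0
  · rw [max_eq_right h0, max_eq_left (by linarith)]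
    ring
  · rw [max_eq_left h0, max_eq_right (by linarith)]
    ring

theorem integrable_pow_smul_of_mem_Icc (hψm : Measurable ψ)
    (hψ : ∀ ω, ψ ω ∈ Set.Icc (0 : ℝ) 1) {E : Type*} [NormedAddCommGroup E] [NormedSpace ℝ E]
    {h : Ω → E} (hh : Integrable h μ) (m : ℕ) : Integrable (fun ω => ψ ω ^ m • h ω) μ := by
  refine hh.mono (((hψm.pow_const m).aestronglyMeasurable).smul hh.1)
    (Filter.Eventually.of_forall fun ω => ?_)
  rw [norm_smul, norm_pow, Real.norm_eq_abs, abs_of_nonneg (hψ ω).1]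
  exact mul_le_of_le_one_left (norm_nonneg _) (pow_le_one₀ (hψ ω).1 (hψ ω).2)

/-- Vanishing moments say that the positive and negative parts of `h` push forward under `ψ` to the
same measure. -/
theorem integral_real_smul_eq_zero_of_moments (hψm : Measurable ψ)
    (hψ : ∀ ω, ψ ω ∈ Set.Icc (0 : ℝ) 1) {h : Ω → ℝ} (hh : Integrable h μ)
    (hmom : ∀ m : ℕ, ∫ ω, ψ ω ^ m * h ω ∂μ = 0) {G : ℝ → ℂ} (hG : Measurable G)
    (hGi : Integrable (fun ω => h ω • G (ψ ω)) μ) : ∫ ω, h ω • G (ψ ω) ∂μ = 0 := by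
  have := isFiniteMeasure_densityLaw (ψ := ψ) hh
  have := isFiniteMeasure_densityLaw (ψ := ψ) hh.neg
  have heq : densityLaw μ ψ h = densityLaw μ ψ (-h) := by
    refine measure_eq_of_moments_eq (densityLaw_mem_Icc hψm hψ h)
      (densityLaw_mem_Icc hψm hψ (-h)) fun m => ?_
    have h1 : Integrable (fun ω => h ω • ψ ω ^ m) μ := by
      simpa only [smul_eq_mul, mul_comm] using integrable_pow_smul_of_mem_Icc hψm hψ hh m
    have h2 := integral_smul_eq_sub (G := fun x => x ^ m) hψm hh
      (measurable_id.pow_const m).stronglyMeasurable h1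
    simp only [smul_eq_mul, mul_comm (h _), hmom] at h2
    exact (sub_eq_zero.mp h2.symm)
  rw [integral_smul_eq_sub hψm hh hG.stronglyMeasurable hGi, heq, sub_self]

theorem integral_mul_eq_zero_of_moments (hψm : Measurable ψ)
    (hψ : ∀ ω, ψ ω ∈ Set.Icc (0 : ℝ) 1) {h : Ω → ℂ} (hh : Integrable h μ)
    (hmom : ∀ m : ℕ, ∫ ω, ((ψ ω ^ m : ℝ) : ℂ) * h ω ∂μ = 0) {G : ℝ → ℂ} (hG : Measurable G)
    (hGi : Integrable (fun ω => G (ψ ω) * h ω) μ) : ∫ ω, G (ψ ω) * h ω ∂μ = 0 := by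
  have hGψ : AEStronglyMeasurable (fun ω => G (ψ ω)) μ :=
    (hG.comp hψm).aestronglyMeasurable
  have hmi : ∀ m : ℕ, Integrable (fun ω => ((ψ ω ^ m : ℝ) : ℂ) * h ω) μ := fun m => by
    simpa only [Complex.real_smul] using integrable_pow_smul_of_mem_Icc hψm hψ hh m
  have hre : Integrable (fun ω => (h ω).re • G (ψ ω)) μ := by
    refine hGi.mono (hh.re.1.smul hGψ) (Filter.Eventually.of_forall fun ω => ?_)
    rw [norm_smul, norm_mul, mul_comm]
    gcongr
    exact Complex.abs_re_le_norm _
  have him : Integrable (fun ω => (h ω).im • G (ψ ω)) μ := by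
    refine hGi.mono (hh.im.1.smul hGψ) (Filter.Eventually.of_forall fun ω => ?_)
    rw [norm_smul, norm_mul, mul_comm]
    gcongr
    exact Complex.abs_im_le_norm _
  have h1 := integral_real_smul_eq_zero_of_moments hψm hψ hh.re (fun m => by
    have h2 := integral_re (hmi m)
    rw [hmom m] at h2
    simpa only [RCLike.re_to_complex, Complex.re_ofReal_mul, Complex.zero_re] using h2) hG hre
  have h2 := integral_real_smul_eq_zero_of_moments hψm hψ hh.im (fun m => by
    have h2 := integral_im (hmi m)
    rw [hmom m] at h2
    simpa only [RCLike.im_to_complex, Complex.im_ofReal_mul, Complex.zero_im] using h2) hG him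
  simp only [RCLike.re_to_complex, RCLike.im_to_complex] at h1 h2
  have h3 : ∀ ω, G (ψ ω) * h ω =
      (h ω).re • G (ψ ω) + Complex.I * ((h ω).im • G (ψ ω)) := fun ω => by
    nth_rewrite 1 [← Complex.re_add_im (h ω)]
    simp only [Complex.real_smul]
    ring
  simp only [h3]
  rw [integral_add hre (him.const_mul _), integral_const_mul, h1, h2, mul_zero, add_zero]

end Density

/-- Two complex densities for which the bounded functions `ψ₁`, `ψ₂` have the same moments
integrate all functions of `ψ₁`, `ψ₂` to the same value. -/
theorem integral_mul_eq_of_moments_eq {X Y : Type*} [MeasurableSpace X] [MeasurableSpace Y]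
    {μ : Measure X} {ν : Measure Y} {ψ₁ : X → ℝ} {ψ₂ : Y → ℝ}
    (hm₁ : Measurable ψ₁) (hm₂ : Measurable ψ₂)
    (hψ₁ : ∀ x, ψ₁ x ∈ Set.Icc (0 : ℝ) 1) (hψ₂ : ∀ y, ψ₂ y ∈ Set.Icc (0 : ℝ) 1)
    {h₁ : X → ℂ} {h₂ : Y → ℂ} (hh₁ : Integrable h₁ μ) (hh₂ : Integrable h₂ ν)
    (hmom : ∀ m : ℕ, ∫ x, ((ψ₁ x ^ m : ℝ) : ℂ) * h₁ x ∂μ = ∫ y, ((ψ₂ y ^ m : ℝ) : ℂ) * h₂ y ∂ν)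
    {G : ℝ → ℂ} (hG : Measurable G) (hG₁ : Integrable (fun x => G (ψ₁ x) * h₁ x) μ)
    (hG₂ : Integrable (fun y => G (ψ₂ y) * h₂ y) ν) :
    ∫ x, G (ψ₁ x) * h₁ x ∂μ = ∫ y, G (ψ₂ y) * h₂ y ∂ν := by
  -- On the disjoint union, equality of the two integrals becomes vanishing of one, for the density
  -- `h₁` on X and `-h₂` on Y.
  set κ : Measure (X ⊕ Y) := μ.map Sum.inl + ν.map Sum.inr with hκ
  have hinl : MeasurableEmbedding (Sum.inl : X → X ⊕ Y) :=
    ⟨Sum.inl_injective, measurable_inl, fun _ hs => measurableSet_inl_image.mpr hs⟩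
  have hinr : MeasurableEmbedding (Sum.inr : Y → X ⊕ Y) :=
    ⟨Sum.inr_injective, measurable_inr, fun _ hs => measurableSet_inr_image.mpr hs⟩
  have hint : ∀ F : X ⊕ Y → ℂ, Integrable (fun x => F (Sum.inl x)) μ →
      Integrable (fun y => F (Sum.inr y)) ν → Integrable F κ := fun F h1 h2 =>
    Integrable.add_measure (hinl.integrable_map_iff.mpr h1)
      (hinr.integrable_map_iff.mpr h2)
  have hval : ∀ F : X ⊕ Y → ℂ, Integrable (fun x => F (Sum.inl x)) μ →
      Integrable (fun y => F (Sum.inr y)) ν →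
      ∫ s, F s ∂κ = ∫ x, F (Sum.inl x) ∂μ + ∫ y, F (Sum.inr y) ∂ν := fun F h1 h2 => by
    rw [hκ, integral_add_measure (hinl.integrable_map_iff.mpr h1)
      (hinr.integrable_map_iff.mpr h2),
      hinl.integral_map, hinr.integral_map]
  have hpow₁ : ∀ m : ℕ, Integrable (fun x => ((ψ₁ x ^ m : ℝ) : ℂ) * h₁ x) μ := fun m => by
    simpa only [Complex.real_smul] using integrable_pow_smul_of_mem_Icc hm₁ hψ₁ hh₁ m
  have hpow₂ : ∀ m : ℕ, Integrable (fun y => ((ψ₂ y ^ m : ℝ) : ℂ) * -h₂ y) ν := fun m => by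
    simpa only [Complex.real_smul] using! integrable_pow_smul_of_mem_Icc hm₂ hψ₂ hh₂.neg m
  have hG₂' : Integrable (fun y => G (ψ₂ y) * -h₂ y) ν := by
    simpa only [mul_neg] using! hG₂.neg
  have key := integral_mul_eq_zero_of_moments (μ := κ) (ψ := Sum.elim ψ₁ ψ₂)
    (h := Sum.elim h₁ fun y => -h₂ y) (hm₁.sumElim hm₂)
    (by rintro (x | y) <;> simp only [Sum.elim_inl, Sum.elim_inr, hψ₁, hψ₂])
    (hint _ hh₁ hh₂.neg)
    (fun m => by
      rw [hval _ (hpow₁ m) (hpow₂ m)]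
      simp only [Sum.elim_inl, Sum.elim_inr, mul_neg]
      rw [hmom m, integral_neg, add_neg_cancel]) hG (hint _ hG₁ hG₂')
  rw [hval _ hG₁ hG₂'] at key
  simp only [Sum.elim_inl, Sum.elim_inr, mul_neg] at key
  rw [integral_neg] at key
  exact add_neg_eq_zero.mp key

/-! ### Polynomials in `z` and `z̄` -/

open MvPolynomial in
/-- The value at `(z, z̄)` of a polynomial in two groups of `n` variables. -/
noncomputable def conjEval {n : ℕ} (Q : MvPolynomial (Fin n ⊕ Fin n) ℂ)
    (z : EuclideanSpace ℂ (Fin n)) : ℂ :=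
  eval (Sum.elim (fun j => z j) fun j => starRingEnd ℂ (z j)) Q

section ConjEval

open MvPolynomial

variable {n : ℕ} (Q R : MvPolynomial (Fin n ⊕ Fin n) ℂ) (z v : EuclideanSpace ℂ (Fin n))

@[simp] theorem conjEval_add : conjEval (Q + R) z = conjEval Q z + conjEval R z := map_add _ _ _

@[simp] theorem conjEval_mul : conjEval (Q * R) z = conjEval Q z * conjEval R z := map_mul _ _ _

@[simp] theorem conjEval_C (a : ℂ) : conjEval (C a) z = a := eval_C _

@[simp] theorem conjEval_one : conjEval 1 z = 1 := map_one _

@[simp] theorem conjEval_zero : conjEval 0 z = 0 := map_zero _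

@[simp] theorem conjEval_X_inl (j : Fin n) : conjEval (X (Sum.inl j)) z = z j := eval_X _

@[simp] theorem conjEval_X_inr (j : Fin n) :
    conjEval (X (Sum.inr j)) z = starRingEnd ℂ (z j) := eval_X _

@[simp] theorem conjEval_sum {ι : Type*} (s : Finset ι)
    (F : ι → MvPolynomial (Fin n ⊕ Fin n) ℂ) :
    conjEval (∑ i ∈ s, F i) z = ∑ i ∈ s, conjEval (F i) z := map_sum _ _ _

/-- The derivative in the direction `v` of a polynomial in `z` and `z̄`. -/
noncomputable def dirDeriv (v : EuclideanSpace ℂ (Fin n)) :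
    Derivation ℂ (MvPolynomial (Fin n ⊕ Fin n) ℂ) (MvPolynomial (Fin n ⊕ Fin n) ℂ) :=
  mkDerivation ℂ (Sum.elim (fun j => C (v j)) fun j => C (starRingEnd ℂ (v j)))

theorem hasLineDerivAt_conjEval :
    HasLineDerivAt ℝ (conjEval Q) (conjEval (dirDeriv v Q) z) z v := by
  induction Q using MvPolynomial.induction_on with
  | C a =>
    rw [show dirDeriv v (C a) = 0 from (dirDeriv v).map_algebraMap a, conjEval_zero]
    simpa only [HasLineDerivAt, conjEval_C] using hasDerivAt_const (0 : ℝ) a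
  | add p q hp hq => simpa only [HasLineDerivAt, conjEval_add, map_add] using! HasDerivAt.add hp hq
  | mul_X p i hp =>
    have hX : HasLineDerivAt ℝ (conjEval (X i)) (conjEval (dirDeriv v (X i)) z) z v := by
      rcases i with j | j
      · simp only [HasLineDerivAt, dirDeriv, mkDerivation_X, Sum.elim_inl, conjEval_C,
          conjEval_X_inl, PiLp.add_apply, PiLp.smul_apply, Complex.real_smul]
        simpa using (((hasDerivAt_id (0 : ℝ)).ofReal_comp).mul_const (v j)).const_add (z j)
      · simp only [HasLineDerivAt, dirDeriv, mkDerivation_X, Sum.elim_inr, conjEval_C,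
          conjEval_X_inr, PiLp.add_apply, PiLp.smul_apply, Complex.real_smul, map_add, map_mul,
          Complex.conj_ofReal]
        simpa using (((hasDerivAt_id (0 : ℝ)).ofReal_comp).mul_const
          (starRingEnd ℂ (v j))).const_add (starRingEnd ℂ (z j))
    have h := HasDerivAt.mul hp hX
    simp only [HasLineDerivAt, conjEval_mul, Derivation.leibniz, smul_eq_mul, conjEval_add,
      zero_smul, add_zero] at h ⊢
    convert! h using 1
    ring

theorem contDiff_conjEval (k : WithTop ℕ∞) : ContDiff ℝ k (conjEval Q) := by
  induction Q using MvPolynomial.induction_on with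
  | C a =>
    have e : conjEval (C a : MvPolynomial (Fin n ⊕ Fin n) ℂ) = fun _ => a := by
      funext z
      simp
    rw [e]
    exact contDiff_const
  | add p q hp hq =>
    rw [show conjEval (p + q) = fun z => conjEval p z + conjEval q z from
      _root_.funext fun z => conjEval_add p q z]
    exact hp.add hq
  | mul_X p i hp =>
    have h : ∀ j : Fin n, ContDiff ℝ k fun z : EuclideanSpace ℂ (Fin n) => z j :=
      fun j => contDiff_piLp_apply (𝕜 := ℝ) 2
    rw [show conjEval (p * X i) = fun z => conjEval p z * conjEval (X i) z from
      _root_.funext fun z => conjEval_mul p (X i) z]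
    refine hp.mul ?_
    rcases i with j | j
    · rw [show conjEval (X (Sum.inl j)) = fun z => z j from
        _root_.funext fun z => conjEval_X_inl z j]
      exact h j
    · rw [show conjEval (X (Sum.inr j)) = fun z => starRingEnd ℂ (z j) from
        _root_.funext fun z => conjEval_X_inr z j]
      exact Complex.conjCLE.contDiff.comp (h j)

theorem fderiv_conjEval : fderiv ℝ (conjEval Q) z v = conjEval (dirDeriv v Q) z := by
  have h := (contDiff_conjEval Q 1).differentiable (by simp) z
  rw [← h.lineDeriv_eq_fderiv, (hasLineDerivAt_conjEval Q z v).lineDeriv]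

theorem dirDeriv_single_one (j : Fin n) :
    dirDeriv (EuclideanSpace.single j 1) Q = pderiv (Sum.inl j) Q + pderiv (Sum.inr j) Q := by
  have : dirDeriv (EuclideanSpace.single j (1 : ℂ)) =
      pderiv (R := ℂ) (Sum.inl j : Fin n ⊕ Fin n) + pderiv (Sum.inr j) := by
    refine derivation_ext fun i => ?_
    rcases i with i | i <;>
    · rcases eq_or_ne i j with rfl | h
      · simp [dirDeriv, pderiv_X]
      · simp [dirDeriv, pderiv_X, h]
  rw [this, Derivation.add_apply]

theorem dirDeriv_single_I (j : Fin n) :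
    dirDeriv (EuclideanSpace.single j Complex.I) Q =
      C Complex.I * (pderiv (Sum.inl j) Q - pderiv (Sum.inr j) Q) := by
  have : dirDeriv (EuclideanSpace.single j Complex.I) =
      Complex.I • (pderiv (R := ℂ) (Sum.inl j : Fin n ⊕ Fin n) - pderiv (Sum.inr j)) := by
    refine derivation_ext fun i => ?_
    rcases i with i | i <;>
    · rcases eq_or_ne i j with rfl | h
      · simp [dirDeriv, pderiv_X, smul_eq_C_mul]
      · simp [dirDeriv, pderiv_X, h]
  rw [this, Derivation.smul_apply, Derivation.sub_apply, smul_eq_C_mul]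

theorem pderiv_comm {σ : Type*} (i j : σ) (Q : MvPolynomial σ ℂ) :
    pderiv i (pderiv j Q) = pderiv j (pderiv i Q) := by
  classical
  have : ⁅pderiv (R := ℂ) i, pderiv (R := ℂ) j⁆ = 0 := by
    refine derivation_ext fun k => ?_
    rw [Derivation.commutator_apply]
    simp only [pderiv_X, Pi.single_apply]
    split_ifs <;> simp
  have h := congrArg (fun D => D Q) this
  simpa [Derivation.commutator_apply, sub_eq_zero] using h

/-- A quarter of the Laplacian, on polynomials in `z` and `z̄`. -/
noncomputable def polyLaplacian (Q : MvPolynomial (Fin n ⊕ Fin n) ℂ) :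
    MvPolynomial (Fin n ⊕ Fin n) ℂ :=
  ∑ j, pderiv (Sum.inl j) (pderiv (Sum.inr j) Q)

theorem polyLaplacian_pderiv (i : Fin n ⊕ Fin n) :
    polyLaplacian (pderiv i Q) = pderiv i (polyLaplacian Q) := by
  simp only [polyLaplacian, map_sum]
  refine Finset.sum_congr rfl fun j _ => ?_
  rw [pderiv_comm (Sum.inr j) i, pderiv_comm (Sum.inl j) i]

/-- The orthonormal basis `e_j, i e_j` of the real inner product space `ℂⁿ`. -/
noncomputable def realBasis (n : ℕ) :
    OrthonormalBasis (Σ _ : Fin n, Fin 2) ℝ (EuclideanSpace ℂ (Fin n)) :=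
  Pi.orthonormalBasis fun _ => Complex.orthonormalBasisOneI

open Laplacian in
theorem laplacian_conjEval : (Δ (conjEval Q)) z = 4 * conjEval (polyLaplacian Q) z := by
  have h2 : ∀ v : EuclideanSpace ℂ (Fin n), iteratedFDeriv ℝ 2 (conjEval Q) z ![v, v] =
      conjEval (dirDeriv v (dirDeriv v Q)) z := by
    intro v
    rw [iteratedFDeriv_two_apply]
    have hd : DifferentiableAt ℝ (fderiv ℝ (conjEval Q)) z :=
      ((contDiff_conjEval Q 2).fderiv_right (m := 1) (by norm_num)).differentiable (by simp) z
    have h3 : fderiv ℝ (fun y => fderiv ℝ (conjEval Q) y v) z v =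
        fderiv ℝ (fderiv ℝ (conjEval Q)) z v v := by
      rw [fderiv_clm_apply hd (differentiableAt_const v)]
      simp
    simp only [Matrix.cons_val_zero, Matrix.cons_val_one]
    rw [← h3]
    simp only [fderiv_conjEval]
  rw [InnerProductSpace.laplacian_eq_iteratedFDeriv_orthonormalBasis _ (realBasis n)]
  simp only [h2]
  rw [Fintype.sum_sigma, polyLaplacian, conjEval_sum, Finset.mul_sum]
  refine Finset.sum_congr rfl fun j _ => ?_
  have e0 : realBasis n ⟨j, 0⟩ = EuclideanSpace.single j 1 := by
    simp [realBasis, Pi.orthonormalBasis_apply, EuclideanSpace.single]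
  have e1 : realBasis n ⟨j, 1⟩ = EuclideanSpace.single j Complex.I := by
    simp [realBasis, Pi.orthonormalBasis_apply, EuclideanSpace.single]
  rw [Fin.sum_univ_two, e0, e1, ← conjEval_add]
  simp only [dirDeriv_single_one, dirDeriv_single_I, pderiv_C_mul, map_add, map_sub]
  rw [pderiv_comm (Sum.inr j) (Sum.inl j)]
  rw [show (4 : ℂ) * conjEval (pderiv (Sum.inl j) (pderiv (Sum.inr j) Q)) z =
    conjEval (C 4 * pderiv (Sum.inl j) (pderiv (Sum.inr j) Q)) z by simp]
  congr 1
  have hI : (C Complex.I * C Complex.I : MvPolynomial (Fin n ⊕ Fin n) ℂ) = -1 := by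
    rw [← C_mul, Complex.I_mul_I]
    simp
  have h4 : (C 4 : MvPolynomial (Fin n ⊕ Fin n) ℂ) = 4 := map_ofNat C 4
  rw [h4]
  linear_combination (pderiv (Sum.inl j) (pderiv (Sum.inl j) Q) -
    2 * pderiv (Sum.inl j) (pderiv (Sum.inr j) Q) + pderiv (Sum.inr j) (pderiv (Sum.inr j) Q)) * hI

/-- Substituting x + iy and x - iy for the two groups of variables gives a polynomial vanishing at
all real (x, y), hence zero; the substitution is invertible over ℂ. This turns harmonicity of the
function into the algebraic identity `polyLaplacian Q = 0`. -/
theorem eq_zero_of_conjEval_eq_zero {Q : MvPolynomial (Fin n ⊕ Fin n) ℂ}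
    (h : ∀ z, conjEval Q z = 0) : Q = 0 := by
  set F : Fin n ⊕ Fin n → MvPolynomial (Fin n ⊕ Fin n) ℂ :=
    Sum.elim (fun j => X (Sum.inl j) + C Complex.I * X (Sum.inr j))
      fun j => X (Sum.inl j) - C Complex.I * X (Sum.inr j) with hF
  have hev : ∀ x : Fin n ⊕ Fin n → ℂ, eval x (bind₁ F Q) = eval
      (Sum.elim (fun j => x (Sum.inl j) + Complex.I * x (Sum.inr j))
        fun j => x (Sum.inl j) - Complex.I * x (Sum.inr j)) Q := by
    intro x
    rw [← coe_aeval_eq_eval, ← coe_aeval_eq_eval]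
    simp only [RingHom.coe_coe]
    rw [aeval_bind₁]
    congr 2
    funext i
    rcases i with j | j <;> simp [hF]
  have h0 : bind₁ F Q = 0 := by
    refine funext_set (fun _ => Set.range ((↑) : ℝ → ℂ))
      (fun _ => Set.infinite_range_of_injective Complex.ofReal_injective) fun x hx => ?_
    rw [map_zero, hev, ← h (WithLp.toLp 2 fun j => x (Sum.inl j) + Complex.I * x (Sum.inr j))]
    unfold conjEval
    congr 2
    funext i
    rcases i with j | j
    · simp
    · obtain ⟨s, hs⟩ := hx (Sum.inl j) trivial
      obtain ⟨t, ht⟩ := hx (Sum.inr j) trivial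
      simp [← hs, ← ht, sub_eq_add_neg]
  refine MvPolynomial.funext fun x => ?_
  rw [map_zero]
  have h1 := hev (Sum.elim (fun j => (x (Sum.inl j) + x (Sum.inr j)) / 2)
    fun j => (x (Sum.inl j) - x (Sum.inr j)) / (2 * Complex.I))
  rw [h0, map_zero] at h1
  rw [h1]
  congr 2
  funext i
  have hI : Complex.I ≠ 0 := Complex.I_ne_zero
  rcases i with j | j
  · simp only [Sum.elim_inl, Sum.elim_inr]
    field_simp
    ring
  · simp only [Sum.elim_inl, Sum.elim_inr]
    field_simp
    ring

/-- Bidegree is recorded as scaling by independent `a` and `b`, because Q will be evaluated at pairs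
that are not complex conjugate. -/
theorem exists_conjEval_of_mem_bigradedPoly {p q : ℕ} {P : EuclideanSpace ℂ (Fin n) → ℂ}
    (hP : P ∈ bigradedPoly n p q) : ∃ Q : MvPolynomial (Fin n ⊕ Fin n) ℂ,
      P = conjEval Q ∧ Q.IsHomogeneous (p + q) ∧ ∀ (a b : ℂ) (c d : Fin n → ℂ),
        eval (Sum.elim (a • c) (b • d)) Q = a ^ p * b ^ q * eval (Sum.elim c d) Q := by
  induction hP using Submodule.span_induction with
  | mem P hP =>
    obtain ⟨α, β, hα, hβ, rfl⟩ := hP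
    refine ⟨(∏ j, X (Sum.inl j) ^ α j) * ∏ j, X (Sum.inr j) ^ β j, ?_, ?_, ?_⟩
    · funext z
      simp [conjEval, map_prod]
    · refine IsHomogeneous.mul ?_ ?_
      · rw [← hα]
        exact IsHomogeneous.prod _ _ _ fun j _ => isHomogeneous_X_pow _ _
      · rw [← hβ]
        exact IsHomogeneous.prod _ _ _ fun j _ => isHomogeneous_X_pow _ _
    · intro a b c d
      simp only [map_mul, map_prod, map_pow, eval_X, Sum.elim_inl, Sum.elim_inr, Pi.smul_apply,
        smul_eq_mul, mul_pow, Finset.prod_mul_distrib, Finset.prod_pow_eq_pow_sum, hα, hβ]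
      ring
  | zero => exact ⟨0, by funext z; simp, isHomogeneous_zero _ _ _, by simp⟩
  | add P P' _ _ hP hP' =>
    obtain ⟨Q, rfl, h1, h2⟩ := hP
    obtain ⟨Q', rfl, h1', h2'⟩ := hP'
    refine ⟨Q + Q', by funext z; simp, h1.add h1', fun a b c d => ?_⟩
    rw [map_add, map_add, h2, h2', mul_add]
  | smul s P _ hP =>
    obtain ⟨Q, rfl, h1, h2⟩ := hP
    refine ⟨C s * Q, by funext z; simp, ?_, fun a b c d => ?_⟩
    · simpa using (isHomogeneous_C _ s).mul h1
    · simp only [map_mul, h2, eval_C]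
      ring

theorem exists_conjEval_of_mem_bigradedHarmonic {p q : ℕ} {P : EuclideanSpace ℂ (Fin n) → ℂ}
    (hP : P ∈ bigradedHarmonic n p q) : ∃ Q : MvPolynomial (Fin n ⊕ Fin n) ℂ,
      P = conjEval Q ∧ Q.IsHomogeneous (p + q) ∧ polyLaplacian Q = 0 ∧
        ∀ (a b : ℂ) (c d : Fin n → ℂ),
          eval (Sum.elim (a • c) (b • d)) Q = a ^ p * b ^ q * eval (Sum.elim c d) Q := by
  obtain ⟨Q, rfl, h1, h2⟩ := exists_conjEval_of_mem_bigradedPoly hP.1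
  refine ⟨Q, rfl, h1, eq_zero_of_conjEval_eq_zero fun z => ?_, h2⟩
  have h := hP.2 z
  rw [laplacian_conjEval] at h
  simpa using h

end ConjEval

/-! ### Gaussian integrals of harmonic polynomials -/

theorem integrable_exp_neg_mul_sq_norm {N : ℕ} {T : ℝ} (hT : 0 < T) :
    Integrable fun z : EuclideanSpace ℂ (Fin N) => Real.exp (-T * ‖z‖ ^ 2) := by
  have h := (GaussianFourier.integrable_cexp_neg_mul_sq_norm_add (b := (T : ℂ))
    (by simpa using hT) 0 (0 : EuclideanSpace ℂ (Fin N))).norm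
  refine h.congr (Filter.Eventually.of_forall fun z => ?_)
  simp only [Complex.norm_exp]
  congr 1
  simp [← Complex.ofReal_pow]

/-- Completing the square absorbs the linear term into half of the Gaussian. -/
theorem integrable_of_norm_le_gaussian {N : ℕ} {E : Type*} [NormedAddCommGroup E]
    {F : EuclideanSpace ℂ (Fin N) → E} (hF : AEStronglyMeasurable F) {T : ℝ} (hT : 0 < T) (C B : ℝ)
    (h : ∀ z, ‖F z‖ ≤ C * Real.exp (B * ‖z‖ - T * ‖z‖ ^ 2)) : Integrable F := by
  have hi := (integrable_exp_neg_mul_sq_norm (N := N) (half_pos hT)).const_mul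
    (|C| * Real.exp (B ^ 2 / (2 * T)))
  refine hi.mono' hF (Filter.Eventually.of_forall fun z => (h z).trans ?_)
  calc C * Real.exp (B * ‖z‖ - T * ‖z‖ ^ 2)
      ≤ |C| * Real.exp (B ^ 2 / (2 * T) + -(T / 2) * ‖z‖ ^ 2) := by
        gcongr
        · exact le_abs_self C
        · have h1 : B ^ 2 / (2 * T) + -(T / 2) * ‖z‖ ^ 2 - (B * ‖z‖ - T * ‖z‖ ^ 2) =
              (B - T * ‖z‖) ^ 2 / (2 * T) := by
            field_simp
            ring
          have h2 : 0 ≤ (B - T * ‖z‖) ^ 2 / (2 * T) := by positivity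
          linarith
    _ = _ := by rw [Real.exp_add, mul_assoc]

section

open MvPolynomial

variable {n : ℕ}

/-- An exponential bound replaces polynomial growth: it passes through the induction easily and is
what `integrable_of_norm_le_gaussian` accepts. -/
theorem exists_norm_conjEval_le (Q : MvPolynomial (Fin n ⊕ Fin n) ℂ) :
    ∃ C B : ℝ, 0 ≤ C ∧ 0 ≤ B ∧ ∀ z, ‖conjEval Q z‖ ≤ C * Real.exp (B * ‖z‖) := by
  induction Q using MvPolynomial.induction_on with
  | C a => exact ⟨‖a‖, 0, norm_nonneg _, le_rfl, fun z => by simp⟩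
  | add p q hp hq =>
    obtain ⟨C₁, B₁, hC₁, hB₁, h₁⟩ := hp
    obtain ⟨C₂, B₂, hC₂, hB₂, h₂⟩ := hq
    refine ⟨C₁ + C₂, B₁ + B₂, by positivity, by positivity, fun z => ?_⟩
    have hz := norm_nonneg z
    rw [conjEval_add]
    refine (norm_add_le _ _).trans ((add_le_add (h₁ z) (h₂ z)).trans ?_)
    rw [add_mul C₁]
    gcongr <;> linarith
  | mul_X p i hp =>
    obtain ⟨C₁, B₁, hC₁, hB₁, h₁⟩ := hp
    refine ⟨C₁, B₁ + 1, hC₁, by positivity, fun z => ?_⟩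
    have hX : ‖conjEval (X i) z‖ ≤ Real.exp ‖z‖ := by
      have h : ∀ j, ‖z j‖ ≤ Real.exp ‖z‖ := fun j =>
        (PiLp.norm_apply_le z j).trans ((le_add_of_nonneg_right zero_le_one).trans
          (Real.add_one_le_exp _))
      rcases i with j | j
      · simpa using h j
      · simpa using h j
    rw [conjEval_mul, norm_mul, add_mul, one_mul, Real.exp_add, ← mul_assoc]
    exact mul_le_mul (h₁ z) hX (norm_nonneg _) (by positivity)

/-- The exponent `-T |z|² + ∑ c_j z_j + ∑ d_j z̄_j`. -/
noncomputable def gaussPoly (T : ℝ) (c d : Fin n → ℂ) : MvPolynomial (Fin n ⊕ Fin n) ℂ :=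
  ∑ j, (C (-(T : ℂ)) * (X (Sum.inl j) * X (Sum.inr j)) + C (c j) * X (Sum.inl j) +
    C (d j) * X (Sum.inr j))

theorem conjEval_gaussPoly (T : ℝ) (c d : Fin n → ℂ) (z : EuclideanSpace ℂ (Fin n)) :
    conjEval (gaussPoly T c d) z =
      ((-T * ‖z‖ ^ 2 : ℝ) : ℂ) + ∑ j, (c j * z j + d j * starRingEnd ℂ (z j)) := by
  simp only [gaussPoly, conjEval_sum, conjEval_add, conjEval_mul, conjEval_C, conjEval_X_inl,
    conjEval_X_inr, Complex.mul_conj]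
  rw [EuclideanSpace.norm_sq_eq]
  simp only [Finset.sum_add_distrib, ← Finset.mul_sum, Complex.normSq_eq_norm_sq]
  push_cast
  ring

theorem norm_exp_gaussPoly_le (T : ℝ) (c d : Fin n → ℂ) (z : EuclideanSpace ℂ (Fin n)) :
    ‖Complex.exp (conjEval (gaussPoly T c d) z)‖ ≤
      Real.exp ((∑ j, (‖c j‖ + ‖d j‖)) * ‖z‖ - T * ‖z‖ ^ 2) := by
  rw [conjEval_gaussPoly, Complex.norm_exp, Complex.add_re, Complex.ofReal_re]
  gcongr
  have : (∑ j, (c j * z j + d j * starRingEnd ℂ (z j))).re ≤ (∑ j, (‖c j‖ + ‖d j‖)) * ‖z‖ := by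
    refine (Complex.re_le_norm _).trans ((norm_sum_le _ _).trans ?_)
    rw [Finset.sum_mul]
    gcongr with j
    refine (norm_add_le _ _).trans ?_
    rw [norm_mul, norm_mul, RCLike.norm_conj, ← add_mul]
    gcongr
    exact PiLp.norm_apply_le z j
  linarith

theorem integrable_conjEval_mul_gaussian {T : ℝ} (hT : 0 < T) (c d : Fin n → ℂ)
    (Q : MvPolynomial (Fin n ⊕ Fin n) ℂ) :
    Integrable fun z => conjEval Q z * Complex.exp (conjEval (gaussPoly T c d) z) := by
  obtain ⟨C, B, hC, hB, h⟩ := exists_norm_conjEval_le Q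
  have h1 := (contDiff_conjEval Q 0).continuous
  have h2 := (contDiff_conjEval (gaussPoly T c d) 0).continuous
  refine integrable_of_norm_le_gaussian (by fun_prop) hT C (B + ∑ j, (‖c j‖ + ‖d j‖)) fun z => ?_
  rw [norm_mul]
  refine (mul_le_mul (h z) (norm_exp_gaussPoly_le T c d z) (norm_nonneg _)
    (by positivity)).trans (le_of_eq ?_)
  rw [mul_assoc, ← Real.exp_add]
  ring_nf

/-- The moment of `Q(z, z̄)` for the density `exp(-T |z|² + ∑ c_j z_j + ∑ d_j z̄_j)`. -/
noncomputable def gaussMoment (T : ℝ) (c d : Fin n → ℂ) (Q : MvPolynomial (Fin n ⊕ Fin n) ℂ) : ℂ :=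
  ∫ z, conjEval Q z * Complex.exp (conjEval (gaussPoly T c d) z)

variable {T : ℝ} (hT : 0 < T) (c d : Fin n → ℂ) (Q R : MvPolynomial (Fin n ⊕ Fin n) ℂ)

include hT in
theorem gaussMoment_add : gaussMoment T c d (Q + R) = gaussMoment T c d Q + gaussMoment T c d R := by
  simp only [gaussMoment, conjEval_add, add_mul]
  exact integral_add (integrable_conjEval_mul_gaussian hT c d Q)
    (integrable_conjEval_mul_gaussian hT c d R)

theorem gaussMoment_C_mul (a : ℂ) : gaussMoment T c d (C a * Q) = a * gaussMoment T c d Q := by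
  simp only [gaussMoment, conjEval_mul, conjEval_C, mul_assoc]
  exact integral_const_mul _ _

theorem gaussMoment_zero : gaussMoment T c d 0 = 0 := by
  simp [gaussMoment]

include hT in
theorem gaussMoment_sum {ι : Type*} (s : Finset ι) (F : ι → MvPolynomial (Fin n ⊕ Fin n) ℂ) :
    gaussMoment T c d (∑ i ∈ s, F i) = ∑ i ∈ s, gaussMoment T c d (F i) := by
  classical
  induction s using Finset.induction_on with
  | empty => simp [gaussMoment_zero]
  | insert i s hi ih => rw [Finset.sum_insert hi, Finset.sum_insert hi, gaussMoment_add hT, ih]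

include hT in
-- Integration by parts against the constant 1: the directional derivative of Q exp(E) has integral
-- zero.
theorem gaussMoment_dirDeriv (v : EuclideanSpace ℂ (Fin n)) :
    gaussMoment T c d (dirDeriv v Q + Q * dirDeriv v (gaussPoly T c d)) = 0 := by
  set E := gaussPoly T c d with hE
  have hline : ∀ z, HasLineDerivAt ℝ
      (fun z => conjEval Q z * Complex.exp (conjEval E z))
      (conjEval (dirDeriv v Q + Q * dirDeriv v E) z * Complex.exp (conjEval E z)) z v := by
    intro z
    have h := HasDerivAt.mul (hasLineDerivAt_conjEval Q z v)
      (HasDerivAt.cexp (hasLineDerivAt_conjEval E z v))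
    simp only [zero_smul, add_zero] at h
    unfold HasLineDerivAt
    convert! h using 1
    simp only [conjEval_add, conjEval_mul]
    ring
  have h := integral_bilinear_hasLineDerivAt_right_eq_neg_left_of_integrable
    (μ := (volume : Measure (EuclideanSpace ℂ (Fin n)))) (v := v) (B := ContinuousLinearMap.mul ℝ ℂ)
    (f := fun _ => 1) (f' := fun _ => 0)
    (g := fun z => conjEval Q z * Complex.exp (conjEval E z))
    (g' := fun z => conjEval (dirDeriv v Q + Q * dirDeriv v E) z * Complex.exp (conjEval E z))
    (by simp) (by simpa only [ContinuousLinearMap.mul_apply', one_mul] using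
      integrable_conjEval_mul_gaussian hT c d _)
    (by simpa using integrable_conjEval_mul_gaussian hT c d Q)
    (fun z _ => by simpa only [HasLineDerivAt] using hasDerivAt_const (0 : ℝ) (1 : ℂ))
    (fun z _ => hline z)
  simpa [gaussMoment] using h

include hT in
-- The directions e_j and i e_j give the sum and the difference of the two Wirtinger identities.
theorem gaussMoment_pderiv (i : Fin n ⊕ Fin n) :
    gaussMoment T c d (pderiv i Q + Q * pderiv i (gaussPoly T c d)) = 0 := by
  set E := gaussPoly T c d with hE
  have h1 : ∀ j, gaussMoment T c d (pderiv (Sum.inl j) Q + Q * pderiv (Sum.inl j) E) +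
      gaussMoment T c d (pderiv (Sum.inr j) Q + Q * pderiv (Sum.inr j) E) = 0 := fun j => by
    rw [← gaussMoment_add hT, ← gaussMoment_dirDeriv hT c d Q (EuclideanSpace.single j 1),
      dirDeriv_single_one, dirDeriv_single_one]
    congr 1
    ring
  have h2 : ∀ j, gaussMoment T c d (pderiv (Sum.inl j) Q + Q * pderiv (Sum.inl j) E) -
      gaussMoment T c d (pderiv (Sum.inr j) Q + Q * pderiv (Sum.inr j) E) = 0 := fun j => by
    have h := gaussMoment_dirDeriv hT c d Q (EuclideanSpace.single j Complex.I)
    rw [dirDeriv_single_I, dirDeriv_single_I, ← hE, show C Complex.I *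
      (pderiv (Sum.inl j) Q - pderiv (Sum.inr j) Q) +
      Q * (C Complex.I * (pderiv (Sum.inl j) E - pderiv (Sum.inr j) E)) =
      C Complex.I * ((pderiv (Sum.inl j) Q + Q * pderiv (Sum.inl j) E) +
        C (-1) * (pderiv (Sum.inr j) Q + Q * pderiv (Sum.inr j) E)) by
      simp only [map_neg, map_one]; ring, gaussMoment_C_mul, gaussMoment_add hT,
      gaussMoment_C_mul, mul_eq_zero, or_iff_right Complex.I_ne_zero] at h
    linear_combination h
  rcases i with j | j
  · linear_combination (h1 j + h2 j) / 2
  · linear_combination (h1 j - h2 j) / 2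

theorem pderiv_inl_gaussPoly (j : Fin n) :
    pderiv (Sum.inl j) (gaussPoly T c d) = C (-(T : ℂ)) * X (Sum.inr j) + C (c j) := by
  simp [gaussPoly, pderiv_X, Pi.single_apply, Finset.sum_add_distrib]

theorem pderiv_inr_gaussPoly (j : Fin n) :
    pderiv (Sum.inr j) (gaussPoly T c d) = C (-(T : ℂ)) * X (Sum.inl j) + C (d j) := by
  simp [gaussPoly, pderiv_X, Pi.single_apply, Finset.sum_add_distrib]

include hT in
theorem gaussMoment_X_inl_mul (j : Fin n) : gaussMoment T c d (X (Sum.inl j) * Q) =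
    (d j * gaussMoment T c d Q + gaussMoment T c d (pderiv (Sum.inr j) Q)) / T := by
  have h := gaussMoment_pderiv hT c d Q (Sum.inr j)
  rw [pderiv_inr_gaussPoly, show pderiv (Sum.inr j) Q + Q * (C (-(T : ℂ)) * X (Sum.inl j) + C (d j))
    = pderiv (Sum.inr j) Q + (C (-(T : ℂ)) * (X (Sum.inl j) * Q) + C (d j) * Q) by ring,
    gaussMoment_add hT, gaussMoment_add hT, gaussMoment_C_mul, gaussMoment_C_mul] at h
  have : (T : ℂ) ≠ 0 := by exact_mod_cast hT.ne'
  field_simp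
  linear_combination -h

include hT in
theorem gaussMoment_X_inr_mul (j : Fin n) : gaussMoment T c d (X (Sum.inr j) * Q) =
    (c j * gaussMoment T c d Q + gaussMoment T c d (pderiv (Sum.inl j) Q)) / T := by
  have h := gaussMoment_pderiv hT c d Q (Sum.inl j)
  rw [pderiv_inl_gaussPoly, show pderiv (Sum.inl j) Q + Q * (C (-(T : ℂ)) * X (Sum.inr j) + C (c j))
    = pderiv (Sum.inl j) Q + (C (-(T : ℂ)) * (X (Sum.inr j) * Q) + C (c j) * Q) by ring,
    gaussMoment_add hT, gaussMoment_add hT, gaussMoment_C_mul, gaussMoment_C_mul] at h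
  have : (T : ℂ) ≠ 0 := by exact_mod_cast hT.ne'
  field_simp
  linear_combination -h

include hT in
-- Induction on the degree through Euler's identity (N + 1) Q = ∑ z_j ∂_j Q + z̄_j ∂̄_j Q.
-- Integration by parts replaces z_j by d_j/T and z̄_j by c_j/T, up to second-order terms ∂_j∂̄_j Q
-- whose sum vanishes by harmonicity. The first derivatives are again harmonic, and Euler's identity
-- at the point (d/T, c/T) reassembles Q.
theorem gaussMoment_harmonic {N : ℕ} {Q : MvPolynomial (Fin n ⊕ Fin n) ℂ}
    (hQ : Q.IsHomogeneous N) (hh : polyLaplacian Q = 0) :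
    gaussMoment T c d Q = eval (Sum.elim (fun j => d j / T) fun j => c j / T) Q *
      gaussMoment T c d 1 := by
  have hTC : (T : ℂ) ≠ 0 := by exact_mod_cast hT.ne'
  induction N generalizing Q with
  | zero =>
    have : Q = C (coeff 0 Q) := (totalDegree_eq_zero_iff_eq_C).mp (Nat.le_zero.mp hQ.totalDegree_le)
    rw [this, ← mul_one (C (coeff 0 Q)), gaussMoment_C_mul]
    simp
  | succ N ih =>
    have hd : ∀ i, gaussMoment T c d (pderiv i Q) =
        eval (Sum.elim (fun j => d j / T) fun j => c j / T) (pderiv i Q) * gaussMoment T c d 1 :=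
      fun i => ih (by simpa using hQ.pderiv (i := i)) (by rw [polyLaplacian_pderiv, hh, map_zero])
    have hEuler := hQ.sum_X_mul_pderiv
    rw [Fintype.sum_sum_type] at hEuler
    have hlap : ∑ j, gaussMoment T c d (pderiv (Sum.inl j) (pderiv (Sum.inr j) Q)) = 0 := by
      rw [← gaussMoment_sum hT, ← polyLaplacian, hh, gaussMoment_zero]
    have hsmul : (N + 1) • Q = C ((N + 1 : ℕ) : ℂ) * Q := by
      rw [nsmul_eq_mul, map_natCast]
    have h1 := congrArg (gaussMoment T c d) hEuler
    have h2 := congrArg (eval (Sum.elim (fun j => d j / (T : ℂ)) fun j => c j / T)) hEuler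
    rw [hsmul, gaussMoment_C_mul, gaussMoment_add hT, gaussMoment_sum hT, gaussMoment_sum hT] at h1
    simp only [gaussMoment_X_inl_mul hT, gaussMoment_X_inr_mul hT, add_div, Finset.sum_add_distrib,
      ← Finset.sum_div, pderiv_comm (Sum.inr _) (Sum.inl _), hlap, zero_div, add_zero] at h1
    rw [hsmul] at h2
    simp only [map_add, map_sum, map_mul, eval_X, Sum.elim_inl, Sum.elim_inr, eval_C] at h2
    simp only [hd, Finset.sum_div] at h1
    have hN : ((N + 1 : ℕ) : ℂ) ≠ 0 := by exact_mod_cast Nat.succ_ne_zero N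
    refine mul_left_cancel₀ hN ?_
    rw [← mul_assoc, ← h2, ← h1, add_mul, Finset.sum_mul, Finset.sum_mul]
    congr 1 <;> refine Finset.sum_congr rfl fun j _ => ?_ <;> ring

include hT in
-- In real coordinates cz + dz̄ = (c + d)x + i(c - d)y, and (c + d)² - (c - d)² = 4cd.
theorem gaussMoment_one : gaussMoment T c d 1 =
    (Real.pi / T : ℂ) ^ n * Complex.exp ((∑ j, c j * d j) / T) := by
  have hTC : (T : ℂ) ≠ 0 := by exact_mod_cast hT.ne'
  let γ : (Σ _ : Fin n, Fin 2) → ℂ := fun i =>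
    ![c i.1 + d i.1, Complex.I * (c i.1 - d i.1)] i.2
  have hmp := (PiLp.volume_preserving_ofLp (Σ _ : Fin n, Fin 2)).comp
    (realBasis n).measurePreserving_repr
  have hemb : MeasurableEmbedding ((@WithLp.ofLp 2 ((Σ _ : Fin n, Fin 2) → ℝ)) ∘
      (realBasis n).repr) :=
    ((MeasurableEquiv.toLp 2 ((Σ _ : Fin n, Fin 2) → ℝ)).symm.measurableEmbedding).comp
      (realBasis n).repr.toMeasurableEquiv.measurableEmbedding
  have h := hmp.integral_comp hemb fun v : (Σ _ : Fin n, Fin 2) → ℝ =>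
    Complex.exp (-(T : ℂ) * ∑ i, (v i : ℂ) ^ 2 + ∑ i, γ i * v i)
  rw [GaussianFourier.integral_cexp_neg_mul_sum_add (by simpa using hT)] at h
  rw [gaussMoment]
  convert! h using 1
  · refine integral_congr_ae (Filter.Eventually.of_forall fun z => ?_)
    have r0 : ∀ j, (realBasis n).repr z ⟨j, 0⟩ = (z j).re := fun j => rfl
    have r1 : ∀ j, (realBasis n).repr z ⟨j, 1⟩ = (z j).im := fun j => rfl
    simp only [conjEval_one, one_mul, Function.comp_apply]
    rw [conjEval_gaussPoly]
    congr 2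
    · rw [EuclideanSpace.norm_sq_eq, Fintype.sum_sigma]
      push_cast
      congr 1
      refine Finset.sum_congr rfl fun j _ => ?_
      rw [Fin.sum_univ_two, r0, r1]
      norm_cast
      rw [← Complex.normSq_eq_norm_sq, Complex.normSq_apply]
      ring
    · rw [Fintype.sum_sigma]
      refine Finset.sum_congr rfl fun j _ => ?_
      rw [Fin.sum_univ_two, r0, r1]
      simp only [γ, Matrix.cons_val_zero, Matrix.cons_val_one]
      have hz : starRingEnd ℂ (z j) = (z j).re - (z j).im * Complex.I := by
        apply Complex.ext <;> simp
      rw [hz]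
      nth_rewrite 1 [← Complex.re_add_im (z j)]
      ring
  · congr 1
    · rw [Fintype.card_sigma]
      simp only [Fintype.card_fin, Finset.sum_const, Finset.card_univ, smul_eq_mul]
      push_cast
      rw [mul_div_assoc, div_self two_ne_zero, mul_one, Complex.cpow_natCast]
    · congr 1
      rw [Fintype.sum_sigma, Finset.sum_div, Finset.sum_div]
      refine Finset.sum_congr rfl fun j _ => ?_
      rw [Fin.sum_univ_two]
      simp only [γ, Matrix.cons_val_zero, Matrix.cons_val_one, mul_pow, Complex.I_sq]
      field_simp
      ring

end

/-! ### Moments of the kernel of convolution with a Laguerre function -/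

/-- The kernel of the twisted convolution with the Laguerre function `φ_k^a(√τ ·)`. -/
noncomputable def laguerreKernel {N : ℕ} (τ : ℝ) (k a : ℕ) (z u : EuclideanSpace ℂ (Fin N)) : ℂ :=
  (scaledLaguerreFun τ k a (z - u) : ℂ) *
    Complex.exp (-(Complex.I / 2 * ((τ * (∑ j, z j * starRingEnd ℂ (u j)).im : ℝ) : ℂ)))

section

variable {N : ℕ} {τ : ℝ}

/-- With w = z - u the phase only changes sign, since z·z̄ is real. -/
theorem heisenbergIntegrand_sub_left (τ : ℝ) (k a : ℕ) (F : EuclideanSpace ℂ (Fin N) → ℂ)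
    (z u : EuclideanSpace ℂ (Fin N)) :
    heisenbergIntegrand τ F (fun w => (scaledLaguerreFun τ k a w : ℂ)) z (z - u) =
      F u * laguerreKernel τ k a z u := by
  have h : (∑ j, z j * starRingEnd ℂ ((z - u) j)).im = -(∑ j, z j * starRingEnd ℂ (u j)).im := by
    simp only [PiLp.sub_apply, map_sub, mul_sub, Finset.sum_sub_distrib, Complex.sub_im,
      Complex.mul_conj, ← Complex.ofReal_sum, Complex.ofReal_im, zero_sub]
  simp only [heisenbergIntegrand, laguerreKernel, h, sub_sub_cancel]
  push_cast
  ring_nf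

theorem integrable_heisenbergIntegrand_iff (τ : ℝ) (k a : ℕ) (F : EuclideanSpace ℂ (Fin N) → ℂ)
    (z : EuclideanSpace ℂ (Fin N)) :
    Integrable (heisenbergIntegrand τ F (fun w => (scaledLaguerreFun τ k a w : ℂ)) z) ↔
      Integrable fun u => F u * laguerreKernel τ k a z u := by
  simp only [← heisenbergIntegrand_sub_left]
  exact (integrable_comp_sub_left _ z).symm

theorem heisenbergConv_eq (τ : ℝ) (k a : ℕ) (F : EuclideanSpace ℂ (Fin N) → ℂ)
    (z : EuclideanSpace ℂ (Fin N)) :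
    heisenbergConv τ F (fun w => (scaledLaguerreFun τ k a w : ℂ)) z =
      ∫ u, F u * laguerreKernel τ k a z u := by
  simp only [← heisenbergIntegrand_sub_left]
  exact (integral_sub_left_eq_self _ volume z).symm

theorem continuous_laguerreKernel (k a : ℕ) (z : EuclideanSpace ℂ (Fin N)) :
    Continuous (laguerreKernel τ k a z) := by
  have := continuous_scaledLaguerreFun (N := N) τ k a
  have h : Continuous fun u : EuclideanSpace ℂ (Fin N) =>
      (∑ j, z j * starRingEnd ℂ (u j)).im := by
    refine Complex.continuous_im.comp (continuous_finsetSum _ fun j _ => ?_)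
    exact continuous_const.mul (Complex.continuous_conj.comp (PiLp.continuous_apply 2 _ j))
  unfold laguerreKernel
  fun_prop

theorem norm_laguerreKernel_le (hτ : 0 < τ) (k a : ℕ) (z u : EuclideanSpace ℂ (Fin N)) :
    ‖laguerreKernel τ k a z u‖ ≤
      4 ^ k * ((4 / 3) ^ (a + 1) * Real.exp (τ / 12 * ‖z‖ ^ 2)) *
        Real.exp (-(τ / 24) * ‖u‖ ^ 2) := by
  have h1 : ‖laguerreKernel τ k a z u‖ = |scaledLaguerreFun τ k a (z - u)| := by
    rw [laguerreKernel, norm_mul, Complex.norm_exp]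
    simp
  -- Half of the Gaussian decay is given up, so that it can be measured in u instead of z - u.
  have h2 : ‖u‖ ^ 2 / 2 - ‖z‖ ^ 2 ≤ ‖z - u‖ ^ 2 := by
    have h3 : ‖u‖ ≤ ‖z‖ + ‖z - u‖ := by
      rw [norm_sub_rev]
      calc ‖u‖ = ‖z + (u - z)‖ := by rw [add_sub_cancel]
        _ ≤ _ := norm_add_le _ _
    nlinarith [norm_nonneg u, norm_nonneg z, norm_nonneg (z - u), sq_nonneg (‖z‖ - ‖z - u‖)]
  rw [h1]
  refine (abs_scaledLaguerreFun_le hτ k a _).trans ?_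
  have h4 : Real.exp (-(τ / 12) * ‖z - u‖ ^ 2) ≤
      Real.exp (τ / 12 * ‖z‖ ^ 2) * Real.exp (-(τ / 24) * ‖u‖ ^ 2) := by
    rw [← Real.exp_add]
    gcongr
    nlinarith
  calc _ ≤ (4 / 3) ^ (a + 1) * 4 ^ k *
        (Real.exp (τ / 12 * ‖z‖ ^ 2) * Real.exp (-(τ / 24) * ‖u‖ ^ 2)) := by gcongr
    _ = _ := by ring

/-- With s = z·ū and κ = τ(1 + r)/(4(1 - r)), the mixed terms are 2κ Re s - (iτ/2) Im s = (κ - τ/4)s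
+ (κ + τ/4)s̄. The coefficient κ - τ/4 = τr/(2(1 - r)) of s carries the factor r that later singles
out p over q. -/
theorem hasSum_laguerreKernel (hτ : 0 < τ) {r : ℝ} (hr : |r| < 1) (a : ℕ)
    (z u : EuclideanSpace ℂ (Fin N)) :
    HasSum (fun k => (r : ℂ) ^ k * laguerreKernel τ k a z u)
      (((1 - r)⁻¹ ^ (a + 1) * Real.exp (-(τ / 4 * ((1 + r) / (1 - r))) * ‖z‖ ^ 2) : ℝ) *
        Complex.exp (conjEval (gaussPoly (τ / 4 * ((1 + r) / (1 - r)))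
          (fun j => ((τ / (2 * (1 - r)) : ℝ) : ℂ) * starRingEnd ℂ (z j))
          fun j => ((τ * r / (2 * (1 - r)) : ℝ) : ℂ) * z j) u)) := by
  have h := (Complex.hasSum_ofReal.mpr (hasSum_scaledLaguerreFun hτ hr a (z - u))).mul_right
    (Complex.exp (-(Complex.I / 2 * ((τ * (∑ j, z j * starRingEnd ℂ (u j)).im : ℝ) : ℂ))))
  convert! h using 1
  · funext k
    rw [laguerreKernel]
    push_cast
    ring
  · have hr1 : 1 - r ≠ 0 := by have := (abs_lt.mp hr).2; linarith
    rw [conjEval_gaussPoly]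
    set s := ∑ j, z j * starRingEnd ℂ (u j) with hs
    have hs' : ∑ j, (((τ / (2 * (1 - r)) : ℝ) : ℂ) * starRingEnd ℂ (z j) * u j +
        ((τ * r / (2 * (1 - r)) : ℝ) : ℂ) * z j * starRingEnd ℂ (u j)) =
        ((τ / (2 * (1 - r)) : ℝ) : ℂ) * starRingEnd ℂ s + ((τ * r / (2 * (1 - r)) : ℝ) : ℂ) * s := by
      rw [hs, map_sum, Finset.mul_sum, Finset.mul_sum, ← Finset.sum_add_distrib]
      refine Finset.sum_congr rfl fun j _ => ?_
      rw [map_mul, Complex.conj_conj]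
      ring
    have hnorm : ‖z - u‖ ^ 2 = ‖z‖ ^ 2 + ‖u‖ ^ 2 - 2 * s.re := by
      rw [EuclideanSpace.norm_sq_eq, EuclideanSpace.norm_sq_eq, EuclideanSpace.norm_sq_eq, hs,
        Complex.re_sum, Finset.mul_sum, ← Finset.sum_add_distrib, ← Finset.sum_sub_distrib]
      refine Finset.sum_congr rfl fun j _ => ?_
      simp only [PiLp.sub_apply, ← Complex.normSq_eq_norm_sq, Complex.normSq_apply, Complex.sub_re,
        Complex.sub_im, Complex.mul_re, Complex.conj_re, Complex.conj_im]
      ring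
    have hsc : starRingEnd ℂ s = s.re - s.im * Complex.I := by
      apply Complex.ext <;> simp
    have hsr : (s : ℂ) = s.re + s.im * Complex.I := (Complex.re_add_im s).symm
    rw [hs', hnorm]
    push_cast
    rw [mul_assoc, mul_assoc, ← Complex.exp_add, ← Complex.exp_add, hsc]
    congr 2
    have hr2 : (1 : ℂ) - r ≠ 0 := by exact_mod_cast hr1
    field_simp
    linear_combination (4 * τ * r : ℂ) * hsr

theorem integrable_conjEval_mul_laguerreKernel (hτ : 0 < τ) (k a : ℕ)
    (Q : MvPolynomial (Fin N ⊕ Fin N) ℂ) (z : EuclideanSpace ℂ (Fin N)) :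
    Integrable fun u => conjEval Q u * laguerreKernel τ k a z u := by
  obtain ⟨C, B, hC, hB, h⟩ := exists_norm_conjEval_le Q
  have h1 := (contDiff_conjEval Q 0).continuous
  have h2 := continuous_laguerreKernel (τ := τ) k a z
  refine integrable_of_norm_le_gaussian (by fun_prop) (show 0 < τ / 24 by positivity)
    (C * (4 ^ k * ((4 / 3) ^ (a + 1) * Real.exp (τ / 12 * ‖z‖ ^ 2)))) B fun u => ?_
  rw [norm_mul]
  refine (mul_le_mul (h u) (norm_laguerreKernel_le hτ k a z u) (norm_nonneg _)
    (by positivity)).trans (le_of_eq ?_)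
  rw [sub_eq_add_neg, Real.exp_add]
  ring_nf

theorem norm_exp_neg_mul_sq_norm_le_one (t : ℝ) (ht : 0 ≤ t) (u : EuclideanSpace ℂ (Fin N)) :
    ‖((Real.exp (-t * ‖u‖ ^ 2) : ℝ) : ℂ)‖ ≤ 1 := by
  rw [Complex.norm_real, Real.norm_eq_abs, Real.abs_exp, Real.exp_le_one_iff]
  nlinarith [sq_nonneg ‖u‖]

/-- Sum and integral are interchanged by domination: the kernel bound grows like 4^k, so |r| < 1/8
leaves a geometric series of ratio below 1/2. -/
theorem hasSum_integral_laguerreKernel (hτ : 0 < τ) {r : ℝ} (hr : |r| < 1 / 8) (a : ℕ) {t : ℝ}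
    (ht : 0 ≤ t) (Q : MvPolynomial (Fin N ⊕ Fin N) ℂ) (z : EuclideanSpace ℂ (Fin N)) :
    HasSum (fun k => (r : ℂ) ^ k * ∫ u, ((Real.exp (-t * ‖u‖ ^ 2) : ℝ) : ℂ) *
        (conjEval Q u * laguerreKernel τ k a z u))
      (((1 - r)⁻¹ ^ (a + 1) * Real.exp (-(τ / 4 * ((1 + r) / (1 - r))) * ‖z‖ ^ 2) : ℝ) *
        gaussMoment (t + τ / 4 * ((1 + r) / (1 - r)))
          (fun j => ((τ / (2 * (1 - r)) : ℝ) : ℂ) * starRingEnd ℂ (z j))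
          (fun j => ((τ * r / (2 * (1 - r)) : ℝ) : ℂ) * z j) Q) := by
  obtain ⟨C, B, hC, hB, hQ⟩ := exists_norm_conjEval_le Q
  have hcQ := (contDiff_conjEval Q 0).continuous
  have hexp : Continuous fun u : EuclideanSpace ℂ (Fin N) =>
    ((Real.exp (-t * ‖u‖ ^ 2) : ℝ) : ℂ) := by fun_prop
  set g : EuclideanSpace ℂ (Fin N) → ℝ := fun u => ‖conjEval Q u‖ *
    ((4 / 3) ^ (a + 1) * Real.exp (τ / 12 * ‖z‖ ^ 2) * Real.exp (-(τ / 24) * ‖u‖ ^ 2)) with hg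
  have hgi : Integrable g := by
    refine integrable_of_norm_le_gaussian (by fun_prop) (show 0 < τ / 24 by positivity)
      (C * ((4 / 3) ^ (a + 1) * Real.exp (τ / 12 * ‖z‖ ^ 2))) B fun u => ?_
    rw [Real.norm_of_nonneg (by positivity)]
    refine (mul_le_mul_of_nonneg_right (hQ u) (by positivity)).trans (le_of_eq ?_)
    rw [sub_eq_add_neg, Real.exp_add]
    ring_nf
  set F : ℕ → EuclideanSpace ℂ (Fin N) → ℂ := fun k u => (r : ℂ) ^ k *
    (((Real.exp (-t * ‖u‖ ^ 2) : ℝ) : ℂ) * (conjEval Q u * laguerreKernel τ k a z u)) with hF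
  have hFi : ∀ k, Integrable (F k) := fun k =>
    ((integrable_conjEval_mul_laguerreKernel hτ k a Q z).bdd_mul (c := 1)
      hexp.aestronglyMeasurable (Filter.Eventually.of_forall
        fun u => norm_exp_neg_mul_sq_norm_le_one t ht u)).const_mul _
  have hFle : ∀ k u, ‖F k u‖ ≤ (4 * |r|) ^ k * g u := by
    intro k u
    rw [hF, hg]
    simp only [norm_mul, norm_pow, Complex.norm_real, Real.norm_eq_abs]
    have h1 := norm_exp_neg_mul_sq_norm_le_one t ht u
    rw [Complex.norm_real, Real.norm_eq_abs] at h1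
    calc |r| ^ k * (|Real.exp (-t * ‖u‖ ^ 2)| * (‖conjEval Q u‖ * ‖laguerreKernel τ k a z u‖))
        ≤ |r| ^ k * (1 * (‖conjEval Q u‖ *
          (4 ^ k * ((4 / 3) ^ (a + 1) * Real.exp (τ / 12 * ‖z‖ ^ 2)) *
            Real.exp (-(τ / 24) * ‖u‖ ^ 2)))) := by
          gcongr
          exact norm_laguerreKernel_le hτ k a z u
      _ = _ := by ring
  have hsum : Summable fun k => ∫ u, ‖F k u‖ := by
    refine Summable.of_nonneg_of_le (fun k => by positivity) (fun k => ?_)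
      ((summable_geometric_of_lt_one (by positivity)
        (show 4 * |r| < 1 by linarith)).mul_right (∫ u, g u))
    rw [← integral_const_mul]
    exact integral_mono (hFi k).norm (hgi.const_mul _) (hFle k)
  have h := hasSum_integral_of_summable_integral_norm hFi hsum
  convert! h using 1
  · funext k
    exact (integral_const_mul _ _).symm
  · rw [gaussMoment, ← integral_const_mul]
    refine integral_congr_ae (Filter.Eventually.of_forall fun u => ?_)
    have h2 := (((hasSum_laguerreKernel hτ (lt_trans hr (by norm_num)) a z u).mul_left
      (((Real.exp (-t * ‖u‖ ^ 2) : ℝ) : ℂ) * conjEval Q u))).tsum_eq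
    simp only [hF]
    rw [show (fun k : ℕ => (r : ℂ) ^ k * (((Real.exp (-t * ‖u‖ ^ 2) : ℝ) : ℂ) *
      (conjEval Q u * laguerreKernel τ k a z u))) = fun k : ℕ =>
      (((Real.exp (-t * ‖u‖ ^ 2) : ℝ) : ℂ) * conjEval Q u) *
        ((r : ℂ) ^ k * laguerreKernel τ k a z u) from funext fun k => by ring, h2]
    rw [conjEval_gaussPoly, conjEval_gaussPoly, Complex.exp_add, Complex.exp_add]
    rw [show -(t + τ / 4 * ((1 + r) / (1 - r))) * ‖u‖ ^ 2 =
      -t * ‖u‖ ^ 2 + -(τ / 4 * ((1 + r) / (1 - r))) * ‖u‖ ^ 2 by ring, Complex.ofReal_add,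
      Complex.exp_add, ← Complex.ofReal_exp, ← Complex.ofReal_exp]
    ring

open MvPolynomial in
/-- The Gaussian moments of the kernel against a bigraded harmonic polynomial. -/
theorem hasSum_integral_laguerreKernel_harmonic (hτ : 0 < τ) (hN : 0 < N) {r : ℝ}
    (hr : |r| < 1 / 8) {t : ℝ} (ht : 0 ≤ t) {p q : ℕ} {Q : MvPolynomial (Fin N ⊕ Fin N) ℂ}
    (hQ : Q.IsHomogeneous (p + q)) (hlap : polyLaplacian Q = 0)
    (hbi : ∀ (a b : ℂ) (c d : Fin N → ℂ),
        eval (Sum.elim (a • c) (b • d)) Q = a ^ p * b ^ q * eval (Sum.elim c d) Q)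
    (z : EuclideanSpace ℂ (Fin N)) :
    HasSum (fun k => (r : ℂ) ^ k * ∫ u, ((Real.exp (-t * ‖u‖ ^ 2) : ℝ) : ℂ) *
        (conjEval Q u * laguerreKernel τ k (N - 1) z u))
      ((r : ℂ) ^ p * (((τ / (2 * Real.pi)) ^ (p + q) : ℝ) * conjEval Q z *
        (((1 - r)⁻¹ ^ (N + p + q) * (Real.pi / (t + τ / 4 * ((1 + r) / (1 - r)))) ^ (N + p + q) *
          Real.exp (-(τ / 4 * ((1 + r) / (1 - r))) * ‖z‖ ^ 2 +
            τ / (2 * (1 - r)) * (τ * r / (2 * (1 - r))) * ‖z‖ ^ 2 /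
              (t + τ / 4 * ((1 + r) / (1 - r)))) : ℝ) : ℂ))) := by
  have h := hasSum_integral_laguerreKernel hτ hr (N - 1) ht Q z
  obtain ⟨hr1, hr2⟩ := abs_lt.mp hr
  have hr3 : 0 < 1 - r := by linarith
  have hκ : 0 < τ / 4 * ((1 + r) / (1 - r)) := by
    have : 0 < 1 + r := by linarith
    positivity
  set T := t + τ / 4 * ((1 + r) / (1 - r)) with hTdef
  have hT : 0 < T := by positivity
  convert! h using 1
  rw [gaussMoment_harmonic hT _ _ hQ hlap, gaussMoment_one hT]
  set α : ℝ := τ * r / (2 * (1 - r)) with hα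
  set β : ℝ := τ / (2 * (1 - r)) with hβ
  have hev : eval (Sum.elim (fun j => (α : ℂ) * z j / T)
      fun j => (β : ℂ) * starRingEnd ℂ (z j) / T) Q =
      ((α / T : ℝ) : ℂ) ^ p * ((β / T : ℝ) : ℂ) ^ q * conjEval Q z := by
    rw [conjEval, ← hbi]
    congr 2
    funext i
    rcases i with j | j <;>
    · simp only [Sum.elim_inl, Sum.elim_inr, Pi.smul_apply, smul_eq_mul]
      push_cast
      ring
  have hcd : (∑ j, (β : ℂ) * starRingEnd ℂ (z j) * ((α : ℂ) * z j)) / (T : ℂ) =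
      ((β * α * ‖z‖ ^ 2 / T : ℝ) : ℂ) := by
    rw [EuclideanSpace.norm_sq_eq]
    push_cast
    congr 1
    rw [Finset.mul_sum]
    refine Finset.sum_congr rfl fun j _ => ?_
    rw [← Complex.conj_mul']
    ring
  rw [hev, hcd, Nat.sub_add_cancel hN, Real.exp_add, ← Complex.ofReal_exp]
  -- Both α/T and β/T contain (τ/2π)(1 - r)⁻¹(π/T), and α/T one further r; collecting p + q of these
  -- raises the exponent N to N + p + q.
  have key : r ^ p * ((τ / (2 * Real.pi)) ^ (p + q) *
      ((1 - r)⁻¹ ^ (N + p + q) * (Real.pi / T) ^ (N + p + q))) =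
      (1 - r)⁻¹ ^ N * ((α / T) ^ p * (β / T) ^ q * (Real.pi / T) ^ N) := by
    rw [hα, hβ]
    have hpi := Real.pi_ne_zero
    have e1 : τ * r / (2 * (1 - r)) / T = r * (τ / (2 * Real.pi) * ((1 - r)⁻¹ * (Real.pi / T))) := by
      field_simp
    have e2 : τ / (2 * (1 - r)) / T = τ / (2 * Real.pi) * ((1 - r)⁻¹ * (Real.pi / T)) := by
      field_simp
    rw [e1, e2]
    ring
  have keyC : (r : ℂ) ^ p * (((τ / (2 * Real.pi)) ^ (p + q) : ℝ) *
      (((1 - r)⁻¹ ^ (N + p + q) : ℝ) * ((Real.pi / T) ^ (N + p + q) : ℝ))) =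
      (((1 - r)⁻¹ ^ N : ℝ) : ℂ) * (((α / T : ℝ) : ℂ) ^ p * ((β / T : ℝ) : ℂ) ^ q *
        (Real.pi / T : ℂ) ^ N) := by
    exact_mod_cast congrArg (Complex.ofReal) key
  rw [Complex.ofReal_mul, Complex.ofReal_mul, Complex.ofReal_mul, Complex.ofReal_mul]
  linear_combination (conjEval Q z * (Real.exp (-(τ / 4 * ((1 + r) / (1 - r))) * ‖z‖ ^ 2) : ℝ) *
    (Real.exp (β * α * ‖z‖ ^ 2 / T) : ℝ)) * keyC

open MvPolynomial in
-- Apart from r^p and the factor with Q(z), the generating function depends only on N + p + q and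
-- |z|. It is therefore the one for Q = 1 in dimension n + p + q at a point of the same norm, and
-- the coefficients can be compared.
theorem integral_exp_mul_laguerreKernel {n : ℕ} (hτ : 0 < τ) (hn : 0 < n) {t : ℝ} (ht : 0 ≤ t)
    {p q : ℕ} {Q : MvPolynomial (Fin n ⊕ Fin n) ℂ}
    (hQ : Q.IsHomogeneous (p + q)) (hlap : polyLaplacian Q = 0)
    (hbi : ∀ (a b : ℂ) (c d : Fin n → ℂ),
        eval (Sum.elim (a • c) (b • d)) Q = a ^ p * b ^ q * eval (Sum.elim c d) Q)
    (z : EuclideanSpace ℂ (Fin n)) (z' : EuclideanSpace ℂ (Fin (n + p + q))) (hz : ‖z'‖ = ‖z‖)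
    (k : ℕ) :
    ∫ u, ((Real.exp (-t * ‖u‖ ^ 2) : ℝ) : ℂ) * (conjEval Q u * laguerreKernel τ k (n - 1) z u) =
      if p ≤ k then ((τ / (2 * Real.pi)) ^ (p + q) : ℝ) * conjEval Q z *
        ∫ w, ((Real.exp (-t * ‖w‖ ^ 2) : ℝ) : ℂ) *
          laguerreKernel τ (k - p) (n + p + q - 1) z' w
      else 0 := by
  have hα := fun (r : ℝ) (hr : |r| < 1 / 8) =>
    hasSum_integral_laguerreKernel_harmonic hτ hn hr ht hQ hlap hbi z
  have hone : ∀ (a b : ℂ) (c d : Fin (n + p + q) → ℂ), eval (Sum.elim (a • c) (b • d)) 1 =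
      a ^ 0 * b ^ 0 * eval (Sum.elim c d) (1 : MvPolynomial (Fin (n + p + q) ⊕ _) ℂ) := by
    simp
  have hβ : ∀ r : ℝ, |r| < 1 / 8 → HasSum (fun k => (r : ℂ) ^ k *
      if p ≤ k then ((τ / (2 * Real.pi)) ^ (p + q) : ℝ) * conjEval Q z *
        ∫ w, ((Real.exp (-t * ‖w‖ ^ 2) : ℝ) : ℂ) *
          laguerreKernel τ (k - p) (n + p + q - 1) z' w
      else 0) _ := fun r hr => by
    have h1 := hasSum_integral_laguerreKernel_harmonic hτ (show 0 < n + p + q by omega) hr ht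
      (p := 0) (q := 0) (isHomogeneous_one _ _) (by simp [polyLaplacian]) hone z'
    have h2 := h1.mul_left ((r : ℂ) ^ p * (((τ / (2 * Real.pi)) ^ (p + q) : ℝ) * conjEval Q z))
    -- The factor r^p is a shift of the index by p; the terms with k < p are zero.
    refine ((add_left_injective p).hasSum_iff ?_).mp ?_
    · intro k hk
      have : ¬ p ≤ k := fun h => hk ⟨k - p, Nat.sub_add_cancel h⟩
      rw [if_neg this, mul_zero]
    · convert! h2 using 1
      funext k
      simp only [Function.comp_apply, conjEval_one, one_mul, le_add_iff_nonneg_left, zero_le,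
        if_true, Nat.add_sub_cancel, pow_add]
      ring
  refine congrFun (eq_of_hasSum_pow (β := fun k =>
    if p ≤ k then ((τ / (2 * Real.pi)) ^ (p + q) : ℝ) * conjEval Q z *
        ∫ w, ((Real.exp (-t * ‖w‖ ^ 2) : ℝ) : ℂ) *
          laguerreKernel τ (k - p) (n + p + q - 1) z' w
      else 0) (show (0 : ℝ) < 1 / 8 by norm_num) hα fun r hr => ?_) k
  convert! hβ r hr using 1
  simp only [pow_zero, one_mul, conjEval_one, mul_one, add_zero, Complex.ofReal_one, hz]
  ring

end

/-! ### The Hecke–Bochner identity for the standard twisted convolution -/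

theorem integrable_densityLaw_iff {Ω : Type*} [MeasurableSpace Ω] {μ : Measure Ω} {ψ : Ω → ℝ}
    (hψm : Measurable ψ) {h : Ω → ℝ} (hh : Measurable h) {E : Type*} [NormedAddCommGroup E]
    [NormedSpace ℝ E] {G : ℝ → E} (hG : StronglyMeasurable G) :
    Integrable G (densityLaw μ ψ h) ↔ Integrable (fun ω => max (h ω) 0 • G (ψ ω)) μ := by
  rw [densityLaw, integrable_map_measure hG.aestronglyMeasurable hψm.aemeasurable,
    integrable_withDensity_iff_integrable_smul' hh.ennreal_ofReal
      (Filter.Eventually.of_forall fun _ => ENNReal.ofReal_lt_top)]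
  simp only [ENNReal.toReal_ofReal', Function.comp_apply]

/-- Substitution of √t u: the real dimension 2N contributes t^N and the homogeneity of |P|²
contributes t^d. -/
theorem integral_exp_mul_norm_sq_of_homogeneous {N d : ℕ} {P : EuclideanSpace ℂ (Fin N) → ℂ}
    (hP : ∀ (s : ℝ) (u : EuclideanSpace ℂ (Fin N)), P (s • u) = (s : ℂ) ^ d * P u) {t : ℝ}
    (ht : 0 < t) :
    ∫ u, Real.exp (-t * ‖u‖ ^ 2) * ‖P u‖ ^ 2 =
      (t ^ (N + d))⁻¹ * ∫ u, Real.exp (-1 * ‖u‖ ^ 2) * ‖P u‖ ^ 2 := by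
  have h := Measure.integral_comp_smul (volume : Measure (EuclideanSpace ℂ (Fin N)))
    (fun u => Real.exp (-1 * ‖u‖ ^ 2) * ‖P u‖ ^ 2) (Real.sqrt t)
  have hdim : Module.finrank ℝ (EuclideanSpace ℂ (Fin N)) = 2 * N := by
    rw [← Module.finrank_mul_finrank ℝ ℂ, Complex.finrank_real_complex, finrank_euclideanSpace_fin]
  have hsq : Real.sqrt t ^ 2 = t := Real.sq_sqrt ht.le
  rw [hdim, pow_mul, hsq, abs_of_pos (by positivity), smul_eq_mul] at h
  have hF : ∀ u : EuclideanSpace ℂ (Fin N),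
      Real.exp (-1 * ‖Real.sqrt t • u‖ ^ 2) * ‖P (Real.sqrt t • u)‖ ^ 2 =
        t ^ d * (Real.exp (-t * ‖u‖ ^ 2) * ‖P u‖ ^ 2) := by
    intro u
    rw [hP, norm_smul, norm_mul, norm_pow, Complex.norm_real, Real.norm_of_nonneg (Real.sqrt_nonneg _),
      mul_pow, mul_pow, ← pow_mul, mul_comm d 2, pow_mul, hsq]
    ring_nf
  simp only [hF, integral_const_mul] at h
  rw [pow_add, mul_inv, mul_assoc, mul_comm (t ^ d)⁻¹, ← mul_assoc, ← h]
  field_simp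

theorem measurable_exp_neg_sq_norm {N : ℕ} :
    Measurable fun u : EuclideanSpace ℂ (Fin N) => Real.exp (-1 * ‖u‖ ^ 2) := by fun_prop

theorem exp_neg_sq_norm_mem_Icc {N : ℕ} (u : EuclideanSpace ℂ (Fin N)) :
    Real.exp (-1 * ‖u‖ ^ 2) ∈ Set.Icc (0 : ℝ) 1 :=
  ⟨(Real.exp_pos _).le, by rw [Real.exp_le_one_iff]; nlinarith [sq_nonneg ‖u‖]⟩

theorem exp_neg_sq_norm_pow {N : ℕ} (u : EuclideanSpace ℂ (Fin N)) (m : ℕ) :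
    Real.exp (-1 * ‖u‖ ^ 2) ^ m = Real.exp (-(m : ℝ) * ‖u‖ ^ 2) := by
  rw [← Real.exp_nat_mul]
  ring_nf

theorem sqrt_neg_log_exp_neg_sq_norm {N : ℕ} (u : EuclideanSpace ℂ (Fin N)) :
    Real.sqrt (-Real.log (Real.exp (-1 * ‖u‖ ^ 2))) = ‖u‖ := by
  rw [Real.log_exp, neg_mul, one_mul, neg_neg, Real.sqrt_sq (norm_nonneg _)]

open MvPolynomial

variable {n p q : ℕ} {Q : MvPolynomial (Fin n ⊕ Fin n) ℂ}

theorem conjEval_real_smul (hbi : ∀ (a b : ℂ) (c d : Fin n → ℂ),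
      eval (Sum.elim (a • c) (b • d)) Q = a ^ p * b ^ q * eval (Sum.elim c d) Q)
    (s : ℝ) (u : EuclideanSpace ℂ (Fin n)) :
    conjEval Q (s • u) = (s : ℂ) ^ (p + q) * conjEval Q u := by
  rw [conjEval, conjEval, pow_add, ← hbi]
  congr 2
  funext i
  rcases i with j | j <;> simp

theorem exists_norm_conjEval_mul_exp_le (Q : MvPolynomial (Fin n ⊕ Fin n) ℂ) {ε : ℝ} (hε : 0 < ε) :
    ∃ M : ℝ, ∀ u, ‖conjEval Q u‖ * Real.exp (-ε * ‖u‖ ^ 2) ≤ M := by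
  obtain ⟨C, B, hC, hB, h⟩ := exists_norm_conjEval_le Q
  refine ⟨C * Real.exp (B ^ 2 / (4 * ε)), fun u => ?_⟩
  refine (mul_le_mul_of_nonneg_right (h u) (Real.exp_pos _).le).trans ?_
  rw [mul_assoc, ← Real.exp_add]
  gcongr
  have h1 : B ^ 2 / (4 * ε) - (B * ‖u‖ + -ε * ‖u‖ ^ 2) = (B - 2 * ε * ‖u‖) ^ 2 / (4 * ε) := by
    field_simp
    ring
  have h2 : 0 ≤ (B - 2 * ε * ‖u‖) ^ 2 / (4 * ε) := by positivity
  linarith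

theorem integrable_exp_mul_norm_sq_conjEval (Q : MvPolynomial (Fin n ⊕ Fin n) ℂ) {ε : ℝ}
    (hε : 0 < ε) : Integrable fun u => Real.exp (-ε * ‖u‖ ^ 2) * ‖conjEval Q u‖ ^ 2 := by
  obtain ⟨C, B, hC, hB, h⟩ := exists_norm_conjEval_le Q
  have h1 := (contDiff_conjEval Q 0).continuous
  refine integrable_of_norm_le_gaussian (by fun_prop) hε (C ^ 2) (2 * B) fun u => ?_
  rw [Real.norm_of_nonneg (by positivity)]
  calc Real.exp (-ε * ‖u‖ ^ 2) * ‖conjEval Q u‖ ^ 2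
      ≤ Real.exp (-ε * ‖u‖ ^ 2) * (C * Real.exp (B * ‖u‖)) ^ 2 := by gcongr; exact h u
    _ = C ^ 2 * (Real.exp (-ε * ‖u‖ ^ 2) * Real.exp (B * ‖u‖) * Real.exp (B * ‖u‖)) := by ring
    _ = _ := by
      rw [← Real.exp_add, ← Real.exp_add]
      ring_nf

/-- The weights `|P|²` on `ℂⁿ` and `1` on `ℂ^{n+p+q}` have proportional radial parts. -/
theorem densityLaw_norm_sq_conjEval (hbi : ∀ (a b : ℂ) (c d : Fin n → ℂ),
      eval (Sum.elim (a • c) (b • d)) Q = a ^ p * b ^ q * eval (Sum.elim c d) Q) {ε : ℝ}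
    (hε : 0 < ε) :
    densityLaw volume (fun u : EuclideanSpace ℂ (Fin n) => Real.exp (-1 * ‖u‖ ^ 2))
      (fun u => (∫ w : EuclideanSpace ℂ (Fin (n + p + q)), Real.exp (-1 * ‖w‖ ^ 2)) *
        (Real.exp (-ε * ‖u‖ ^ 2) * ‖conjEval Q u‖ ^ 2)) =
    densityLaw volume (fun w : EuclideanSpace ℂ (Fin (n + p + q)) => Real.exp (-1 * ‖w‖ ^ 2))
      (fun w => (∫ u, Real.exp (-1 * ‖u‖ ^ 2) * ‖conjEval Q u‖ ^ 2) *
        Real.exp (-ε * ‖w‖ ^ 2)) := by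
  set M' := ∫ w : EuclideanSpace ℂ (Fin (n + p + q)), Real.exp (-1 * ‖w‖ ^ 2) with hM'
  set M := ∫ u, Real.exp (-1 * ‖u‖ ^ 2) * ‖conjEval Q u‖ ^ 2 with hM
  have hM'0 : 0 ≤ M' := integral_nonneg fun _ => (Real.exp_pos _).le
  have hM0 : 0 ≤ M := integral_nonneg fun _ => by positivity
  have i₁ := (integrable_exp_mul_norm_sq_conjEval Q hε).const_mul M'
  have i₂ := (integrable_exp_neg_mul_sq_norm (N := n + p + q) hε).const_mul M
  have := isFiniteMeasure_densityLaw
    (ψ := fun u : EuclideanSpace ℂ (Fin n) => Real.exp (-1 * ‖u‖ ^ 2)) i₁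
  have := isFiniteMeasure_densityLaw
    (ψ := fun w : EuclideanSpace ℂ (Fin (n + p + q)) => Real.exp (-1 * ‖w‖ ^ 2)) i₂
  refine measure_eq_of_moments_eq
    (densityLaw_mem_Icc measurable_exp_neg_sq_norm exp_neg_sq_norm_mem_Icc _)
    (densityLaw_mem_Icc measurable_exp_neg_sq_norm exp_neg_sq_norm_mem_Icc _) fun m => ?_
  have hpow : StronglyMeasurable fun x : ℝ => x ^ m := (measurable_id.pow_const m).stronglyMeasurable
  rw [integral_densityLaw measurable_exp_neg_sq_norm i₁ hpow,
    integral_densityLaw measurable_exp_neg_sq_norm i₂ hpow]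
  have ht : 0 < ε + m := by positivity
  have e₁ : ∀ u : EuclideanSpace ℂ (Fin n),
      max (M' * (Real.exp (-ε * ‖u‖ ^ 2) * ‖conjEval Q u‖ ^ 2)) 0 •
        Real.exp (-1 * ‖u‖ ^ 2) ^ m =
      M' * (Real.exp (-(ε + m) * ‖u‖ ^ 2) * ‖conjEval Q u‖ ^ 2) := fun u => by
    rw [max_eq_left (by positivity), exp_neg_sq_norm_pow, smul_eq_mul, neg_add, add_mul,
      Real.exp_add]
    ring
  have e₂ : ∀ w : EuclideanSpace ℂ (Fin (n + p + q)),
      max (M * Real.exp (-ε * ‖w‖ ^ 2)) 0 • Real.exp (-1 * ‖w‖ ^ 2) ^ m =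
      M * Real.exp (-(ε + m) * ‖w‖ ^ 2) := fun w => by
    rw [max_eq_left (by positivity), exp_neg_sq_norm_pow, smul_eq_mul, neg_add, add_mul,
      Real.exp_add]
    ring
  simp only [e₁, e₂, integral_const_mul]
  -- Both m-th moments equal M M' (ε + m)^{-(n+p+q)}: the degree p + q of Q acts as p + q additional
  -- complex dimensions.
  rw [integral_exp_mul_norm_sq_of_homogeneous (conjEval_real_smul hbi) ht, ← hM]
  have h1 := integral_exp_mul_norm_sq_of_homogeneous (N := n + p + q) (d := 0) (P := fun _ => 1)
    (fun _ _ => by simp) ht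
  simp only [norm_one, one_pow, mul_one, add_zero] at h1
  rw [h1, ← hM', ← add_assoc]
  ring

theorem integral_exp_mul_norm_sq_conjEval_pos {u₀ : EuclideanSpace ℂ (Fin n)}
    (hu₀ : conjEval Q u₀ ≠ 0) : 0 < ∫ u, Real.exp (-1 * ‖u‖ ^ 2) * ‖conjEval Q u‖ ^ 2 := by
  have h1 := (contDiff_conjEval Q 0).continuous
  have hc : Continuous fun u => Real.exp (-1 * ‖u‖ ^ 2) * ‖conjEval Q u‖ ^ 2 := by fun_prop
  rw [integral_pos_iff_support_of_nonneg (fun u => by positivity)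
    (integrable_exp_mul_norm_sq_conjEval Q one_pos)]
  refine hc.isOpen_support.measure_pos volume ⟨u₀, ?_⟩
  simpa [Function.mem_support] using hu₀

/-- Multiplying gQ by the bounded function Q̄ exp(-ε|u|²) makes g|Q|² exp(-ε|u|²) integrable on ℂⁿ.
Equality of radial laws moves this to g exp(-ε|w|²) on ℂ^{n+p+q}, and with ε = τ/24 this dominates
the kernel. A point where Q does not vanish is needed to divide by the mass M of |Q|². -/
theorem integrable_radial_mul_laguerreKernel {τ : ℝ} (hτ : 0 < τ)
    (hbi : ∀ (a b : ℂ) (c d : Fin n → ℂ),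
      eval (Sum.elim (a • c) (b • d)) Q = a ^ p * b ^ q * eval (Sum.elim c d) Q)
    {g₀ : ℝ → ℂ} (hg₀ : Measurable g₀)
    (hgi : Integrable fun u : EuclideanSpace ℂ (Fin n) => g₀ ‖u‖ * conjEval Q u)
    {u₀ : EuclideanSpace ℂ (Fin n)} (hu₀ : conjEval Q u₀ ≠ 0) (k a : ℕ)
    (z' : EuclideanSpace ℂ (Fin (n + p + q))) :
    Integrable fun w => g₀ ‖w‖ * laguerreKernel τ k a z' w := by
  have hε : 0 < τ / 24 := by positivity
  have hlaw := densityLaw_norm_sq_conjEval (p := p) (q := q) hbi hε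
  have hM := integral_exp_mul_norm_sq_conjEval_pos hu₀
  set M' := ∫ w : EuclideanSpace ℂ (Fin (n + p + q)), Real.exp (-1 * ‖w‖ ^ 2) with hM'
  set M := ∫ u, Real.exp (-1 * ‖u‖ ^ 2) * ‖conjEval Q u‖ ^ 2 with hMd
  have hM'0 : 0 ≤ M' := integral_nonneg fun _ => (Real.exp_pos _).le
  clear_value M M'
  have hcQ := (contDiff_conjEval Q 0).continuous
  -- This profile recovers g₀(|u|) from exp(-|u|²).
  have hG : Measurable fun y : ℝ => g₀ (Real.sqrt (-Real.log y)) :=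
    hg₀.comp (Real.measurable_log.neg.sqrt)
  obtain ⟨B, hB⟩ := exists_norm_conjEval_mul_exp_le Q hε
  have h1 : Integrable fun u : EuclideanSpace ℂ (Fin n) =>
      max (M' * (Real.exp (-(τ / 24) * ‖u‖ ^ 2) * ‖conjEval Q u‖ ^ 2)) 0 •
        g₀ (Real.sqrt (-Real.log (Real.exp (-1 * ‖u‖ ^ 2)))) := by
    have h := (hgi.bdd_mul (c := M' * B)
      (f := fun u => ((M' * Real.exp (-(τ / 24) * ‖u‖ ^ 2) : ℝ) : ℂ) * starRingEnd ℂ (conjEval Q u))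
      (Continuous.aestronglyMeasurable (by
        have := Complex.continuous_conj.comp hcQ
        simp only [Function.comp_def] at this
        fun_prop))
      (Filter.Eventually.of_forall fun u => by
        rw [norm_mul, RCLike.norm_conj, Complex.norm_real, Real.norm_of_nonneg (by positivity)]
        calc _ = M' * (‖conjEval Q u‖ * Real.exp (-(τ / 24) * ‖u‖ ^ 2)) := by ring
          _ ≤ _ := mul_le_mul_of_nonneg_left (hB u) hM'0))
    refine h.congr (Filter.Eventually.of_forall fun u => ?_)
    simp only
    rw [max_eq_left (by positivity), sqrt_neg_log_exp_neg_sq_norm, Complex.real_smul]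
    push_cast
    rw [← Complex.conj_mul']
    ring
  rw [← integrable_densityLaw_iff measurable_exp_neg_sq_norm
    (h := fun u => M' * (Real.exp (-(τ / 24) * ‖u‖ ^ 2) * ‖conjEval Q u‖ ^ 2))
    (Continuous.measurable (by fun_prop)) hG.stronglyMeasurable, hlaw,
    integrable_densityLaw_iff measurable_exp_neg_sq_norm
      (h := fun w => M * Real.exp (-(τ / 24) * ‖w‖ ^ 2))
    (Continuous.measurable (by fun_prop)) hG.stronglyMeasurable] at h1
  have hK := continuous_laguerreKernel (τ := τ) k a z'
  set X : ℝ := 4 ^ k * ((4 / 3) ^ (a + 1) * Real.exp (τ / 12 * ‖z'‖ ^ 2)) with hX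
  refine (h1.norm.const_mul (M⁻¹ * X)).mono'
    ((hg₀.comp measurable_norm).aestronglyMeasurable.mul hK.aestronglyMeasurable)
    (Filter.Eventually.of_forall fun w => ?_)
  have hw : ‖max (M * Real.exp (-(τ / 24) * ‖w‖ ^ 2)) 0 •
      g₀ (Real.sqrt (-Real.log (Real.exp (-1 * ‖w‖ ^ 2))))‖ =
      M * Real.exp (-(τ / 24) * ‖w‖ ^ 2) * ‖g₀ ‖w‖‖ := by
    rw [max_eq_left (by positivity), sqrt_neg_log_exp_neg_sq_norm, norm_smul,
      Real.norm_of_nonneg (by positivity)]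
  rw [hw, norm_mul]
  calc ‖g₀ ‖w‖‖ * ‖laguerreKernel τ k a z' w‖
      ≤ ‖g₀ ‖w‖‖ * (X * Real.exp (-(τ / 24) * ‖w‖ ^ 2)) :=
        mul_le_mul_of_nonneg_left (norm_laguerreKernel_le hτ k a z' w) (norm_nonneg _)
    _ = (M⁻¹ * M) * (‖g₀ ‖w‖‖ * (X * Real.exp (-(τ / 24) * ‖w‖ ^ 2))) := by
        rw [inv_mul_cancel₀ hM.ne', one_mul]
    _ = M⁻¹ * X * (M * Real.exp (-(τ / 24) * ‖w‖ ^ 2) * ‖g₀ ‖w‖‖) := by ring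

theorem integrable_mul_laguerreKernel {N : ℕ} {τ : ℝ} (hτ : 0 < τ)
    {f : EuclideanSpace ℂ (Fin N) → ℂ} (hf : Integrable f) (k a : ℕ)
    (z : EuclideanSpace ℂ (Fin N)) : Integrable fun u => f u * laguerreKernel τ k a z u := by
  refine hf.mul_bdd (c := 4 ^ k * ((4 / 3) ^ (a + 1) * Real.exp (τ / 12 * ‖z‖ ^ 2)) * 1)
    (continuous_laguerreKernel k a z).aestronglyMeasurable (Filter.Eventually.of_forall fun u => ?_)
  refine (norm_laguerreKernel_le hτ k a z u).trans ?_
  gcongr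
  rw [Real.exp_le_one_iff]
  nlinarith [sq_nonneg ‖u‖]

/-- The Hecke–Bochner identity for Laguerre functions: the kernel formulation. -/
theorem integral_radial_mul_laguerreKernel {τ : ℝ} (hτ : 0 < τ) (hn : 0 < n)
    (hQ : Q.IsHomogeneous (p + q)) (hlap : polyLaplacian Q = 0)
    (hbi : ∀ (a b : ℂ) (c d : Fin n → ℂ),
        eval (Sum.elim (a • c) (b • d)) Q = a ^ p * b ^ q * eval (Sum.elim c d) Q)
    {g₀ : ℝ → ℂ} (hg₀ : Measurable g₀)
    (hgi : Integrable fun u : EuclideanSpace ℂ (Fin n) => g₀ ‖u‖ * conjEval Q u)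
    (z : EuclideanSpace ℂ (Fin n)) (z' : EuclideanSpace ℂ (Fin (n + p + q))) (hz : ‖z'‖ = ‖z‖)
    (k : ℕ) :
    ∫ u, g₀ ‖u‖ * conjEval Q u * laguerreKernel τ k (n - 1) z u =
      if p ≤ k then ((τ / (2 * Real.pi)) ^ (p + q) : ℝ) * conjEval Q z *
        ∫ w : EuclideanSpace ℂ (Fin (n + p + q)), g₀ ‖w‖ *
          laguerreKernel τ (k - p) (n + p + q - 1) z' w
      else 0 := by
  set c : ℂ := if p ≤ k then ((τ / (2 * Real.pi)) ^ (p + q) : ℝ) * conjEval Q z else 0 with hc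
  have hite : ∀ x : ℂ, (if p ≤ k then ((τ / (2 * Real.pi)) ^ (p + q) : ℝ) * conjEval Q z * x
      else 0) = c * x := fun x => by
    rw [hc]
    split_ifs <;> simp
  rw [hite]
  have hG : Measurable fun y : ℝ => g₀ (Real.sqrt (-Real.log y)) :=
    hg₀.comp (Real.measurable_log.neg.sqrt)
  have hi₂ : Integrable fun w : EuclideanSpace ℂ (Fin (n + p + q)) =>
      c * laguerreKernel τ (k - p) (n + p + q - 1) z' w := by
    have := integrable_conjEval_mul_laguerreKernel hτ (k - p) (n + p + q - 1) 1 z'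
    simp only [conjEval_one, one_mul] at this
    exact this.const_mul c
  have hi₃ : Integrable fun w : EuclideanSpace ℂ (Fin (n + p + q)) =>
      g₀ ‖w‖ * (c * laguerreKernel τ (k - p) (n + p + q - 1) z' w) := by
    by_cases hP : conjEval Q z = 0
    · have : c = 0 := by rw [hc, hP, mul_zero, ite_self]
      simp [this]
    · have := (integrable_radial_mul_laguerreKernel hτ hbi hg₀ hgi hP (k - p)
        (n + p + q - 1) z').const_mul c
      refine this.congr (Filter.Eventually.of_forall fun w => ?_)
      simp only
      ring
  -- The m-th moment of exp(-|u|²) is the Gaussian case t = m; the moment m = 0 is why t = 0 was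
  -- allowed there.
  have key := integral_mul_eq_of_moments_eq
    (μ := (volume : Measure (EuclideanSpace ℂ (Fin n))))
    (ν := (volume : Measure (EuclideanSpace ℂ (Fin (n + p + q)))))
    measurable_exp_neg_sq_norm measurable_exp_neg_sq_norm exp_neg_sq_norm_mem_Icc
    exp_neg_sq_norm_mem_Icc (integrable_conjEval_mul_laguerreKernel hτ k (n - 1) Q z) hi₂
    (fun m => by
      simp only [exp_neg_sq_norm_pow]
      rw [integral_exp_mul_laguerreKernel hτ hn (Nat.cast_nonneg m) hQ hlap hbi z z' hz k, hite,
        ← integral_const_mul]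
      refine integral_congr_ae (Filter.Eventually.of_forall fun w => ?_)
      simp only
      ring) hG
    (by
      simp only [sqrt_neg_log_exp_neg_sq_norm, ← mul_assoc]
      exact integrable_mul_laguerreKernel hτ hgi k (n - 1) z)
    (by simpa only [sqrt_neg_log_exp_neg_sq_norm] using hi₃)
  simp only [sqrt_neg_log_exp_neg_sq_norm] at key
  simp only [mul_assoc]
  rw [key, ← integral_const_mul]
  refine integral_congr_ae (Filter.Eventually.of_forall fun w => ?_)
  simp only
  ring

/-! ### Reduction to the standard twisted convolution -/

section LieAlgebraPart

variable {𝔤 : Type*} [LieRing 𝔤] [LieAlgebra ℝ 𝔤] {ip : LinearMap.BilinForm ℝ 𝔤} {n m : ℕ}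
  {e : Module.Basis ((Fin n ⊕ Fin n) ⊕ Fin m) ℝ 𝔤}

theorem IsAdaptedBasis.repr_eq (he : IsAdaptedBasis ip e) (x : 𝔤)
    (i : (Fin n ⊕ Fin n) ⊕ Fin m) : e.repr x i = ip x (e i) := by
  have h : ip (∑ j, e.repr x j • e j) (e i) = e.repr x i := by
    simp only [map_sum, LinearMap.sum_apply, map_smul, LinearMap.smul_apply, he.orthonormal,
      smul_eq_mul, mul_ite, mul_one, mul_zero, Finset.sum_ite_eq', Finset.mem_univ, if_true]
  rw [← h, e.sum_repr x]

theorem twistMatrix_apply (lam : EuclideanSpace ℝ (Fin m)) (j l : Fin n ⊕ Fin n) :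
    twistMatrix ip e lam j l =
      ip (∑ k, lam k • e (Sum.inr k)) ⁅e (Sum.inl j), e (Sum.inl l)⁆ := by
  simp [twistMatrix, structureMatrix, Matrix.sum_apply, map_sum, LinearMap.sum_apply]

/-- For Z = ∑ λ_k Z_k, row j of V holds the coordinates of J_Z B_j. Hence (V²)_{jl} = ⟨Z, [J_Z B_j,
B_l]⟩ = ⟨J_Z² B_j, B_l⟩ = -|λ|² δ_{jl}. -/
theorem twistMatrix_mul_self (hip : IsHType ip) (he : IsAdaptedBasis ip e)
    (lam : EuclideanSpace ℝ (Fin m)) :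
    twistMatrix ip e lam * twistMatrix ip e lam = -(‖lam‖ ^ 2) • (1 : Matrix _ _ ℝ) := by
  set Z : 𝔤 := ∑ k, lam k • e (Sum.inr k) with hZ
  have hZc : Z ∈ LieAlgebra.center ℝ 𝔤 :=
    sum_mem fun k _ => (LieAlgebra.center ℝ 𝔤).smul_mem _ (he.mem_center k)
  have hZZ : ip Z Z = ‖lam‖ ^ 2 := by
    rw [EuclideanSpace.real_norm_sq_eq, hZ]
    simp [map_sum, LinearMap.sum_apply, he.orthonormal, sq]
  obtain ⟨J, hJ, hJJ⟩ := hip.exists_J Z hZc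
  let b : Fin n ⊕ Fin n → horizontal ip := fun j => ⟨e (Sum.inl j), he.mem_horizontal j⟩
  have hV : ∀ j l, twistMatrix ip e lam j l = ip (J (b j) : 𝔤) (e (Sum.inl l)) := fun j l => by
    rw [twistMatrix_apply, ← hZ]
    exact (hJ (b j) (b l)).symm
  have hexp : ∀ j, (J (b j) : 𝔤) = ∑ l, twistMatrix ip e lam j l • e (Sum.inl l) := by
    intro j
    conv_lhs => rw [← e.sum_repr (J (b j) : 𝔤)]
    rw [Fintype.sum_sum_type]
    have h0 : ∀ k, e.repr (J (b j) : 𝔤) (Sum.inr k) = 0 := fun k => by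
      rw [he.repr_eq, hip.symm]
      exact (J (b j)).2 _ (he.mem_center k)
    simp only [h0, zero_smul, Finset.sum_const_zero, add_zero, he.repr_eq, hV]
  ext j l
  have h1 : (twistMatrix ip e lam * twistMatrix ip e lam) j l = ip Z ⁅(J (b j) : 𝔤), e (Sum.inl l)⁆ := by
    rw [Matrix.mul_apply, hexp, sum_lie]
    simp only [smul_lie, map_sum, map_smul, smul_eq_mul]
    refine Finset.sum_congr rfl fun i _ => ?_
    rw [twistMatrix_apply (e := e) lam i l, ← hZ]
  have h2 := hJ (J (b j)) (b l)
  have h3 : J (J (b j)) = -(ip Z Z) • b j := by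
    have := congrArg (fun D => D (b j)) hJJ
    simpa using this
  rw [h1, ← h2, h3, hZZ]
  simp only [b, Submodule.coe_smul, map_smul, LinearMap.smul_apply,
    he.orthonormal, Matrix.smul_apply, Matrix.one_apply, Sum.inl.injEq]

end LieAlgebraPart

variable {n : ℕ}

/-- Conjugation by A turns V² = -τ² into -μ_j² = -τ² on the diagonal, and μ_j > 0 fixes the sign. -/
theorem IsSymplecticFrame.eq_of_mul_self {V A : Matrix (Fin n ⊕ Fin n) (Fin n ⊕ Fin n) ℝ}
    {μ : Fin n → ℝ} (hA : IsSymplecticFrame V A μ) {τ : ℝ} (hτ : 0 < τ)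
    (hV : V * V = -(τ ^ 2) • (1 : Matrix _ _ ℝ)) (j : Fin n) : μ j = τ := by
  have hAA : Aᵀ * A = 1 := by
    simpa [Matrix.star_eq_conjTranspose] using (Matrix.mem_orthogonalGroup_iff' _ _).mp hA.orthogonal
  set D := Matrix.fromBlocks 0 (-Matrix.diagonal μ) (Matrix.diagonal μ) 0 with hD
  have h1 : A * (D * D) = A * (-(τ ^ 2) • (1 : Matrix _ _ ℝ)) := by
    rw [← Matrix.mul_assoc, ← hA.intertwine, Matrix.mul_assoc, ← hA.intertwine, ← Matrix.mul_assoc,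
      hV]
    simp
  have h2 : D * D = -(τ ^ 2) • (1 : Matrix _ _ ℝ) := by
    have := congrArg (fun M => Aᵀ * M) h1
    simpa only [← Matrix.mul_assoc, hAA, Matrix.one_mul] using this
  have h3 := congrFun (congrFun h2 (Sum.inl j)) (Sum.inl j)
  rw [hD, Matrix.fromBlocks_multiply] at h3
  simp only [Matrix.fromBlocks_apply₁₁] at h3
  simp at h3
  have := hA.pos j
  nlinarith

@[simp] theorem realify_complexify (x : Fin n ⊕ Fin n → ℝ) : realify (complexify x) = x := by
  funext i
  rcases i with j | j <;> rfl

theorem norm_sq_eq_realify (z : EuclideanSpace ℂ (Fin n)) :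
    ‖z‖ ^ 2 = realify z ⬝ᵥ realify z := by
  rw [EuclideanSpace.norm_sq_eq, dotProduct, Fintype.sum_sum_type, ← Finset.sum_add_distrib]
  refine Finset.sum_congr rfl fun j _ => ?_
  rw [← Complex.normSq_eq_norm_sq, Complex.normSq_apply]
  rfl

theorem realify_dotProduct_symplectic (τ : ℝ) (z w : EuclideanSpace ℂ (Fin n)) :
    realify z ⬝ᵥ (Matrix.fromBlocks 0 (-Matrix.diagonal fun _ => τ)
      (Matrix.diagonal fun _ => τ) 0) *ᵥ realify w =
      τ * (∑ j, z j * starRingEnd ℂ (w j)).im := by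
  rw [realify, realify, Matrix.fromBlocks_mulVec, Complex.im_sum, dotProduct,
    Fintype.sum_sum_type, ← Finset.sum_add_distrib, Finset.mul_sum]
  refine Finset.sum_congr rfl fun j _ => ?_
  simp [Function.comp_def]
  ring

/-- The linear isometry of `ℂⁿ = ℝ^{2n}` given by an orthogonal matrix. -/
noncomputable def orthogonalIsometry (A : Matrix (Fin n ⊕ Fin n) (Fin n ⊕ Fin n) ℝ)
    (hA : Aᵀ * A = 1) : EuclideanSpace ℂ (Fin n) ≃ₗᵢ[ℝ] EuclideanSpace ℂ (Fin n) :=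
  LinearIsometry.toLinearIsometryEquiv
    { toFun := fun z => complexify (A *ᵥ realify z)
      map_add' := fun z w => by
        rw [show realify (z + w) = realify z + realify w by
          funext i; rcases i with j | j <;> simp [realify], Matrix.mulVec_add]
        ext j
        rfl
      map_smul' := fun c z => by
        rw [show realify (c • z) = c • realify z by
          funext i; rcases i with j | j <;> simp [realify], Matrix.mulVec_smul]
        ext j
        apply Complex.ext <;> simp [complexify]
      norm_map' := fun z => by
        rw [← sq_eq_sq₀ (norm_nonneg _) (norm_nonneg _), norm_sq_eq_realify, norm_sq_eq_realify]
        simp only [LinearMap.coe_mk, AddHom.coe_mk, realify_complexify]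
        rw [Matrix.dotProduct_mulVec, Matrix.vecMul_mulVec, hA, Matrix.vecMul_one] } rfl

theorem orthogonalIsometry_apply (A : Matrix (Fin n ⊕ Fin n) (Fin n ⊕ Fin n) ℝ)
    (hA : Aᵀ * A = 1) (z : EuclideanSpace ℂ (Fin n)) :
    orthogonalIsometry A hA z = complexify (A *ᵥ realify z) := rfl

/-- AᵀVA is τ times the standard symplectic matrix, and the Laguerre function is radial, so only f
feels the rotation. -/
theorem twistedIntegrand_orthogonalIsometry {V A : Matrix (Fin n ⊕ Fin n) (Fin n ⊕ Fin n) ℝ}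
    (hA : Aᵀ * A = 1) {τ : ℝ} (hVA : V * A = A * Matrix.fromBlocks 0 (-Matrix.diagonal fun _ => τ)
      (Matrix.diagonal fun _ => τ) 0)
    (f : EuclideanSpace ℂ (Fin n) → ℂ) (k a : ℕ) (z w : EuclideanSpace ℂ (Fin n)) :
    twistedIntegrand V f (fun w => (scaledLaguerreFun τ k a w : ℂ)) (orthogonalIsometry A hA z)
        (orthogonalIsometry A hA w) =
      heisenbergIntegrand τ (fun u => f (orthogonalIsometry A hA u))
        (fun w => (scaledLaguerreFun τ k a w : ℂ)) z w := by
  have h1 : realify (orthogonalIsometry A hA z) ⬝ᵥ V *ᵥ realify (orthogonalIsometry A hA w) =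
      τ * (∑ j, z j * starRingEnd ℂ (w j)).im := by
    rw [orthogonalIsometry_apply, orthogonalIsometry_apply, realify_complexify, realify_complexify,
      Matrix.mulVec_mulVec, hVA, ← Matrix.mulVec_mulVec, ← realify_dotProduct_symplectic,
      Matrix.dotProduct_mulVec, Matrix.vecMul_mulVec, hA, Matrix.vecMul_one]
  have h2 : scaledLaguerreFun τ k a (orthogonalIsometry A hA w) = scaledLaguerreFun τ k a w := by
    simp only [scaledLaguerreFun, laguerreFun, norm_smul, LinearIsometryEquiv.norm_map]
  simp only [twistedIntegrand, heisenbergIntegrand, h1, h2, map_sub]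

end HTypeHecke

theorem mainTheorem6 {𝔤 : Type*} [LieRing 𝔤] [LieAlgebra ℝ 𝔤]
    (ip : LinearMap.BilinForm ℝ 𝔤) (hip : HTypeHecke.IsHType ip)
    {n m : ℕ} (hn : 0 < n)
    (e : Module.Basis ((Fin n ⊕ Fin n) ⊕ Fin m) ℝ 𝔤) (he : HTypeHecke.IsAdaptedBasis ip e)
    (lam : EuclideanSpace ℝ (Fin m)) (hlam : lam ≠ 0)
    (A : Matrix (Fin n ⊕ Fin n) (Fin n ⊕ Fin n) ℝ) (μ : Fin n → ℝ)
    (hA : HTypeHecke.IsSymplecticFrame (HTypeHecke.twistMatrix ip e lam) A μ)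
    (p q : ℕ) (P : EuclideanSpace ℂ (Fin n) → ℂ) (hP : P ∈ HTypeHecke.twistedHarmonic A p q)
    -- the radial function `g` is given by its profile: `g(z) = g₀(|z|)`, in every dimension
    (g₀ : ℝ → ℂ) (hg₀ : Measurable g₀)
    (f : EuclideanSpace ℂ (Fin n) → ℂ) (hf : Integrable f)
    (hfgP : f =ᵐ[volume] fun z => g₀ ‖z‖ * P z) (k : ℕ) (z : EuclideanSpace ℂ (Fin n)) :
    Integrable (HTypeHecke.twistedIntegrand (HTypeHecke.twistMatrix ip e lam) f
        (fun w => (HTypeHecke.scaledLaguerreFun ‖lam‖ k (n - 1) w : ℂ)) z) ∧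
    (p ≤ k → ∀ z' : EuclideanSpace ℂ (Fin (n + p + q)), ‖z'‖ = ‖z‖ →
      (P ≠ 0 → Integrable (HTypeHecke.heisenbergIntegrand ‖lam‖ (fun w => g₀ ‖w‖)
        (fun w => (HTypeHecke.scaledLaguerreFun ‖lam‖ (k - p) (n + p + q - 1) w : ℂ)) z')) ∧
      HTypeHecke.twistedConv (HTypeHecke.twistMatrix ip e lam) f
          (fun w => (HTypeHecke.scaledLaguerreFun ‖lam‖ k (n - 1) w : ℂ)) z =
        (((2 * Real.pi) ^ (p + q))⁻¹ * ‖lam‖ ^ (p + q) : ℝ) * P z *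
          HTypeHecke.heisenbergConv ‖lam‖ (fun w => g₀ ‖w‖)
            (fun w => (HTypeHecke.scaledLaguerreFun ‖lam‖ (k - p) (n + p + q - 1) w : ℂ)) z') ∧
    (k < p →
      HTypeHecke.twistedConv (HTypeHecke.twistMatrix ip e lam) f
        (fun w => (HTypeHecke.scaledLaguerreFun ‖lam‖ k (n - 1) w : ℂ)) z = 0) := by
  have hτ : 0 < ‖lam‖ := norm_pos_iff.mpr hlam
  set τ := ‖lam‖ with hτdef
  set V := HTypeHecke.twistMatrix ip e lam with hVdef
  have hVV : V * V = -(τ ^ 2) • (1 : Matrix _ _ ℝ) := HTypeHecke.twistMatrix_mul_self hip he lam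
  have hμ : μ = fun _ => τ := funext fun j => hA.eq_of_mul_self hτ hVV j
  have hAA : Aᵀ * A = 1 := by
    simpa [Matrix.star_eq_conjTranspose] using (Matrix.mem_orthogonalGroup_iff' _ _).mp hA.orthogonal
  have hVA := hA.intertwine
  rw [hμ] at hVA
  set R := HTypeHecke.orthogonalIsometry A hAA with hR
  obtain ⟨Q, hPQ, hQ, hlap, hbi⟩ := HTypeHecke.exists_conjEval_of_mem_bigradedHarmonic hP.2
  have hPR : ∀ u, P (R u) = HTypeHecke.conjEval Q u := fun u => congrFun hPQ u
  obtain ⟨y, rfl⟩ := R.surjective z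
  have hmp := R.measurePreserving
  have hemb := R.toMeasurableEquiv.measurableEmbedding
  have hfR : Integrable fun u => f (R u) := (hmp.integrable_comp_emb hemb).mpr hf
  have hfR' : (fun u => f (R u)) =ᵐ[volume] fun u => g₀ ‖u‖ * HTypeHecke.conjEval Q u := by
    filter_upwards [hmp.quasiMeasurePreserving.ae hfgP] with u hu
    rw [hu, hPR, R.norm_map]
  have hgi := hfR.congr hfR'
  have hconv : HTypeHecke.twistedConv V f
      (fun w => (HTypeHecke.scaledLaguerreFun τ k (n - 1) w : ℂ)) (R y) =
      ∫ u, g₀ ‖u‖ * HTypeHecke.conjEval Q u * HTypeHecke.laguerreKernel τ k (n - 1) y u := by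
    rw [HTypeHecke.twistedConv, ← hmp.integral_comp hemb]
    simp only [hR, HTypeHecke.twistedIntegrand_orthogonalIsometry hAA hVA]
    rw [← hR]
    refine (HTypeHecke.heisenbergConv_eq τ k (n - 1) (fun u => f (R u)) y).trans ?_
    refine integral_congr_ae ?_
    filter_upwards [hfR'] with u hu
    rw [hu]
  refine ⟨?_, fun hk z' hz => ⟨fun hP0 => ?_, ?_⟩, fun hk => ?_⟩
  · rw [← hmp.integrable_comp_emb hemb]
    have h := (HTypeHecke.integrable_heisenbergIntegrand_iff τ k (n - 1) (fun u => f (R u)) y).mpr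
      (HTypeHecke.integrable_mul_laguerreKernel hτ hfR k (n - 1) y)
    refine h.congr (Filter.Eventually.of_forall fun w => ?_)
    exact (HTypeHecke.twistedIntegrand_orthogonalIsometry hAA hVA f k (n - 1) y w).symm
  · obtain ⟨u, hu⟩ := Function.ne_iff.mp hP0
    obtain ⟨u₀, rfl⟩ := R.surjective u
    rw [hPR] at hu
    exact (HTypeHecke.integrable_heisenbergIntegrand_iff _ _ _ _ _).mpr
      (HTypeHecke.integrable_radial_mul_laguerreKernel hτ hbi hg₀ hgi hu _ _ z')
  · rw [R.norm_map] at hz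
    rw [hconv, HTypeHecke.integral_radial_mul_laguerreKernel hτ hn hQ hlap hbi hg₀ hgi y z' hz k,
      if_pos hk, HTypeHecke.heisenbergConv_eq, hPR, div_pow, div_eq_inv_mul]
  -- The kernel identity mentions z' even in its vanishing branch, so some vector of the right norm
  -- is supplied; n + p + q > 0 provides a coordinate for it.
  · have hz : ∃ z' : EuclideanSpace ℂ (Fin (n + p + q)), ‖z'‖ = ‖y‖ :=
      ⟨EuclideanSpace.single ⟨0, by omega⟩ (‖y‖ : ℂ), by simp⟩
    obtain ⟨z', hz'⟩ := hz
    rw [hconv, HTypeHecke.integral_radial_mul_laguerreKernel hτ hn hQ hlap hbi hg₀ hgi y z' hz' k,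
      if_neg (not_le.mpr hk)]
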